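/- **Theorem.** Let $(M,g,\Phi)$ be a smooth $\mathrm{Spin}(7)$ manifold: $(M,g)$ is a Riemannian $8$-manifold and $\Phi$ is a $4$-form which near every point can be written, in a smooth orthonormal coframe $e_0,\dots,e_7$, as $$\Phi=e_{0123}+e_{0145}+e_{0167}+e_{0246}-e_{0257}-e_{0347}-e_{0356}+e_{4567}+e_{2367}+e_{2345}+e_{1357}-e_{1346}-e_{1247}-e_{1256},$$ where $e_{ijkl}=e_i\wedge e_j\wedge e_k\wedge e_l$, these coframes being positively oriented for a given orientation of $M$. Let $*$ be the Hodge star of $g$ and this orientation ($\beta\wedge *\alpha=\langle\beta,\alpha\rangle\,\mathrm{vol}$), let $\delta\Phi=-*d*\Phi$, let $P$ be the $3$-fold vector cross product defined by $g(P(x,y,z),t)=\Phi(x,y,z,t)$, and let $\nabla^g$ be the Levi-Civita connection of $g$. Then for all smooth vector fields $X,Y,Z,V,W$ on $M$ $$\begin{aligned} (\nabla^g_X\Phi)(Y,Z,V,W)={}&\tfrac12\left\{\delta\Phi(X,Y,P(Z,V,W))-\delta\Phi(X,Z,P(Y,V,W))\right\}\\ &+\tfrac12\left\{\delta\Phi(X,V,P(Y,Z,W))-\delta\Phi(X,W,P(Y,Z,V))\right\}\\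 &-\tfrac1{12}\left\{*(\delta\Phi\wedge\Phi)\bigl(P(X,Y,P(Z,V,W))\bigr)-*(\delta\Phi\wedge\Phi)\bigl(P(X,Z,P(Y,V,W))\bigr)\right\}\\ &-\tfrac1{12}\left\{*(\delta\Phi\wedge\Phi)\bigl(P(X,V,P(Y,Z,W))\bigr)-*(\delta\Phi\wedge\Phi)\bigl(P(X,W,P(Y,Z,V))\bigr)\right\}. \end{aligned}$$ -/

import Mathlib

open Bundle Module
open scoped Manifold ContDiff RealInnerProductSpace

set_option linter.unusedSectionVars false

noncomputable section

namespace Spin7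

/-! ### Multilinear algebra on an oriented Euclidean vector space -/

section Algebra

variable {V : Type*} [NormedAddCommGroup V] [InnerProductSpace ℝ V] [FiniteDimensional ℝ V]

/-- An alternating form on a finite-dimensional space, viewed as a continuous alternating form. -/
def toContinuous {k : ℕ} (α : V [⋀^Fin k]→ₗ[ℝ] ℝ) : V [⋀^Fin k]→L[ℝ] ℝ where
  toMultilinearMap := α.toMultilinearMap
  cont := by
    have h : ∀ v : Fin k → V, α.toMultilinearMap v =
        ∑ f : Fin k → Fin (finrank ℝ V),
          (∏ i, ⟪stdOrthonormalBasis ℝ V (f i), v i⟫) *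
            α.toMultilinearMap (fun i ↦ stdOrthonormalBasis ℝ V (f i)) := by
      intro v
      have hv : v = fun i ↦ ∑ j, ⟪stdOrthonormalBasis ℝ V j, v i⟫ • stdOrthonormalBasis ℝ V j := by
        funext i
        exact ((stdOrthonormalBasis ℝ V).sum_repr' (v i)).symm
      conv_lhs => rw [hv]
      rw [MultilinearMap.map_sum]
      refine Finset.sum_congr rfl fun f _ ↦ ?_
      rw [MultilinearMap.map_smul_univ, smul_eq_mul]
    change Continuous fun v ↦ α.toMultilinearMap v
    rw [funext h]
    fun_prop
  map_eq_zero_of_eq' := α.map_eq_zero_of_eq'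

/-- The wedge product (determinant convention: a sum over shuffles, without factorials). -/
def wedge {k l : ℕ} (α : V [⋀^Fin k]→L[ℝ] ℝ) (β : V [⋀^Fin l]→L[ℝ] ℝ) :
    V [⋀^Fin (k + l)]→L[ℝ] ℝ :=
  toContinuous (((LinearMap.mul' ℝ ℝ).compAlternatingMap
    (α.toAlternatingMap.domCoprod β.toAlternatingMap)).domDomCongr finSumFinEquiv)

theorem append_update {k l n : ℕ} [DecidableEq (Fin l)] (h : k + l = n) (u : Fin k → V) (w : Fin l → V) (i : Fin l)
    (x : V) : Fin.append u (Function.update w i x) ∘ Fin.cast h.symm =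
      Function.update (Fin.append u w ∘ Fin.cast h.symm) (Fin.cast h (Fin.natAdd k i)) x := by
  subst h
  funext j
  refine Fin.addCases (fun s ↦ ?_) (fun s ↦ ?_) j
  · have hne : Fin.castAdd l s ≠ Fin.natAdd k i := by simp [Fin.ext_iff]; omega
    simp [hne]
  · rcases eq_or_ne s i with rfl | hs
    · simp
    · have hne : Fin.natAdd k s ≠ Fin.natAdd k i := by simpa using hs
      simp [hs, hne]

/-- The `l`-form `w ↦ ω(u, w)` obtained from a `(k + l)`-form `ω` by inserting the vectors
`u 0, …, u (k - 1)` in the first `k` slots. -/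
def insertFirst {k l n : ℕ} (h : k + l = n) (α : V [⋀^Fin n]→ₗ[ℝ] ℝ) (u : Fin k → V) :
    V [⋀^Fin l]→L[ℝ] ℝ :=
  toContinuous
    { toFun := fun w ↦ α (Fin.append u w ∘ Fin.cast h.symm)
      map_update_add' := by
        intro _ w i x y
        change α _ = α _ + α _
        rw [append_update h, append_update h, append_update h, AlternatingMap.map_update_add]
      map_update_smul' := by
        intro _ w i c x
        change α _ = c • α _
        rw [append_update h, append_update h, AlternatingMap.map_update_smul]
      map_eq_zero_of_eq' := by
        intro w i j hw hij
        refine α.map_eq_zero_of_eq _ (i := Fin.cast h (Fin.natAdd k i))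
          (j := Fin.cast h (Fin.natAdd k j)) ?_ ?_
        · simpa using hw
        · simpa using hij }

/-- The Hodge star of an oriented `n`-dimensional Euclidean space, on `k`-forms, `k + l = n`:
`(⋆α)(w) = (1 / k!) ∑ α(e_{i₁}, …, e_{iₖ}) vol(e_{i₁}, …, e_{iₖ}, w)`, the sum being over all
`k`-tuples of vectors of an orthonormal basis. It satisfies `β ∧ ⋆α = ⟨β, α⟩ vol`. -/
def hodgeStar {k l n : ℕ} [Fact (finrank ℝ V = n)] (o : Orientation ℝ V (Fin n)) (h : k + l = n)
    (α : V [⋀^Fin k]→L[ℝ] ℝ) : V [⋀^Fin l]→L[ℝ] ℝ :=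
  (k.factorial : ℝ)⁻¹ • ∑ f : Fin k → Fin (finrank ℝ V),
    α (fun i ↦ stdOrthonormalBasis ℝ V (f i)) •
      insertFirst h o.volumeForm (fun i ↦ stdOrthonormalBasis ℝ V (f i))

/-- The threefold vector cross product of a 4-form: `⟪P(x, y, z), t⟫ = Φ(x, y, z, t)`
(see `inner_crossProduct`). -/
def crossProduct (Φ : V [⋀^Fin 4]→L[ℝ] ℝ) (x y z : V) : V :=
  ∑ i, Φ ![x, y, z, stdOrthonormalBasis ℝ V i] • stdOrthonormalBasis ℝ V i

theorem inner_crossProduct (Φ : V [⋀^Fin 4]→L[ℝ] ℝ) (x y z t : V) :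
    ⟪crossProduct Φ x y z, t⟫ = Φ ![x, y, z, t] := by
  have hu : ∀ s : V, ![x, y, z, s] = Function.update ![x, y, z, 0] 3 s := by
    intro s
    funext i
    fin_cases i <;> rfl
  have hs : Φ ![x, y, z, t] = Φ ![x, y, z, ∑ i,
      ⟪stdOrthonormalBasis ℝ V i, t⟫ • stdOrthonormalBasis ℝ V i] := by
    rw [(stdOrthonormalBasis ℝ V).sum_repr' t]
  rw [hs, hu]
  refine Eq.trans ?_ (Φ.toMultilinearMap.map_update_sum _ _ _ _).symm
  have hi : ∀ i, Φ.toMultilinearMap (Function.update ![x, y, z, 0] 3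
      (⟪stdOrthonormalBasis ℝ V i, t⟫ • stdOrthonormalBasis ℝ V i)) =
      ⟪stdOrthonormalBasis ℝ V i, t⟫ * Φ ![x, y, z, stdOrthonormalBasis ℝ V i] := by
    intro i
    rw [MultilinearMap.map_update_smul, ← hu]
    rfl
  rw [Finset.sum_congr rfl fun i _ ↦ hi i]
  simp [crossProduct, sum_inner, inner_smul_left, mul_comm]

/-- The monomial `e_i ∧ e_j ∧ e_k ∧ e_l` in the standard coordinates of `ℝ⁸`. -/
def monomial (i j k l : Fin 8) : (Fin 8 → ℝ) [⋀^Fin 4]→ₗ[ℝ] ℝ :=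
  Matrix.detRowAlternating.compLinearMap (LinearMap.funLeft ℝ ℝ ![i, j, k, l])

/-- The standard `Spin(7)` form on `ℝ⁸`. -/
def standardForm : (Fin 8 → ℝ) [⋀^Fin 4]→ₗ[ℝ] ℝ :=
  monomial 0 1 2 3 + monomial 0 1 4 5 + monomial 0 1 6 7 + monomial 0 2 4 6
    - monomial 0 2 5 7 - monomial 0 3 4 7 - monomial 0 3 5 6
    + monomial 4 5 6 7 + monomial 2 3 6 7 + monomial 2 3 4 5 + monomial 1 3 5 7
    - monomial 1 3 4 6 - monomial 1 2 4 7 - monomial 1 2 5 6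

end Algebra

/-! ### The Levi-Civita connection -/

section LeviCivita

variable {E : Type*} [NormedAddCommGroup E] [NormedSpace ℝ E]
  {H : Type*} [TopologicalSpace H] {I : ModelWithCorners ℝ E H}
  {M : Type*} [TopologicalSpace M] [ChartedSpace H M]
  [RiemannianBundle (TangentSpace I : M → Type _)]

variable (I) in
/-- Half the right-hand side of the Koszul formula. -/
def koszul (X Y Z : Π p : M, TangentSpace I p) (p : M) : ℝ :=
  (mvfderiv I (fun q ↦ ⟪Y q, Z q⟫) p (X p) + mvfderiv I (fun q ↦ ⟪X q, Z q⟫) p (Y p)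
    - mvfderiv I (fun q ↦ ⟪X q, Y q⟫) p (Z p)
    + ⟪VectorField.mlieBracket I X Y p, Z p⟫ + ⟪VectorField.mlieBracket I Z X p, Y p⟫
    - ⟪VectorField.mlieBracket I Y Z p, X p⟫) / 2

variable [IsManifold I ∞ M] [IsContMDiffRiemannianBundle I ∞ E (TangentSpace I : M → Type _)]
  {X X' Y Y' Z Z' : Π p : M, TangentSpace I p} {f : M → ℝ} {p : M}

theorem mdifferentiableAt_inner (hX : MDiffAt (T% X) p) (hY : MDiffAt (T% Y) p) :
    MDiffAt (fun q ↦ ⟪X q, Y q⟫) p :=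
  have : IsContMDiffRiemannianBundle I 1 E (TangentSpace I : M → Type _) :=
    IsContMDiffRiemannianBundle.of_le (n := ∞) (by simp)
  MDifferentiableAt.inner_bundle (F := E) (E := (TangentSpace I : M → Type _)) (b := fun q : M ↦ q)
    (v := X) (w := Y) hX hY

theorem mvfderiv_inner_smul (hX : MDiffAt (T% X) p) (hY : MDiffAt (T% Y) p) (hf : MDiffAt f p)
    (v : TangentSpace I p) :
    mvfderiv I (fun q ↦ f q * ⟪X q, Y q⟫) p v =
      f p * mvfderiv I (fun q ↦ ⟪X q, Y q⟫) p v + ⟪X p, Y p⟫ * mvfderiv I f p v := by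
  simpa using congr($(mvfderiv_fun_mul hf (mdifferentiableAt_inner hX hY)) v)

theorem mvfderiv_inner_add (hX : MDiffAt (T% X) p) (hX' : MDiffAt (T% X') p)
    (hY : MDiffAt (T% Y) p) (v : TangentSpace I p) :
    mvfderiv I (fun q ↦ ⟪X q, Y q⟫ + ⟪X' q, Y q⟫) p v =
      mvfderiv I (fun q ↦ ⟪X q, Y q⟫) p v + mvfderiv I (fun q ↦ ⟪X' q, Y q⟫) p v := by
  simpa using congr($(mvfderiv_fun_add (mdifferentiableAt_inner hX hY)
    (mdifferentiableAt_inner hX' hY)) v)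

theorem mvfderiv_inner_comm (v : TangentSpace I p) :
    mvfderiv I (fun q ↦ ⟪X q, Y q⟫) p v = mvfderiv I (fun q ↦ ⟪Y q, X q⟫) p v := by
  simp only [real_inner_comm]

variable [FiniteDimensional ℝ E]

theorem koszul_smul_fst (hX : MDiffAt (T% X) p) (hY : MDiffAt (T% Y) p) (hZ : MDiffAt (T% Z) p)
    (hf : MDiffAt f p) : koszul I (f • X) Y Z p = f p * koszul I X Y Z p := by
  have : CompleteSpace E := FiniteDimensional.complete ℝ E
  simp [koszul, inner_smul_left, inner_smul_right, inner_add_left,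
    VectorField.mlieBracket_smul_left hf hX, VectorField.mlieBracket_smul_right hf hX,
    mvfderiv_inner_smul hX hZ hf, mvfderiv_inner_smul hX hY hf]
  ring

theorem koszul_add_fst (hX : MDiffAt (T% X) p) (hX' : MDiffAt (T% X') p)
    (hY : MDiffAt (T% Y) p) (hZ : MDiffAt (T% Z) p) :
    koszul I (X + X') Y Z p = koszul I X Y Z p + koszul I X' Y Z p := by
  have : CompleteSpace E := FiniteDimensional.complete ℝ E
  simp [koszul, inner_add_left, inner_add_right,
    VectorField.mlieBracket_add_left hX hX', VectorField.mlieBracket_add_right hX hX',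
    mvfderiv_inner_add hX hX' hZ, mvfderiv_inner_add hX hX' hY]
  ring

theorem koszul_smul_snd (hX : MDiffAt (T% X) p) (hY : MDiffAt (T% Y) p) (hZ : MDiffAt (T% Z) p)
    (hf : MDiffAt f p) : koszul I X (f • Y) Z p =
      f p * koszul I X Y Z p + mvfderiv I f p (X p) * ⟪Y p, Z p⟫ := by
  have : CompleteSpace E := FiniteDimensional.complete ℝ E
  simp [koszul, inner_smul_left, inner_smul_right, inner_add_left, real_inner_comm,
    VectorField.mlieBracket_smul_left hf hY, VectorField.mlieBracket_smul_right hf hY,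
    mvfderiv_inner_smul hY hZ hf, mvfderiv_inner_smul hX hY hf]
  ring

theorem koszul_add_snd (hX : MDiffAt (T% X) p) (hY : MDiffAt (T% Y) p)
    (hY' : MDiffAt (T% Y') p) (hZ : MDiffAt (T% Z) p) :
    koszul I X (Y + Y') Z p = koszul I X Y Z p + koszul I X Y' Z p := by
  have : CompleteSpace E := FiniteDimensional.complete ℝ E
  have h : mvfderiv I (fun q ↦ ⟪X q, Y q⟫ + ⟪X q, Y' q⟫) p (Z p) =
      mvfderiv I (fun q ↦ ⟪X q, Y q⟫) p (Z p) + mvfderiv I (fun q ↦ ⟪X q, Y' q⟫) p (Z p) := by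
    simpa only [real_inner_comm] using mvfderiv_inner_add hY hY' hX (Z p)
  simp [koszul, inner_add_left, inner_add_right,
    VectorField.mlieBracket_add_left hY hY', VectorField.mlieBracket_add_right hY hY',
    mvfderiv_inner_add hY hY' hZ, h]
  ring

/-- `∇_X Y - ∇_Y X = [X, Y]`. -/
theorem koszul_sub_swap :
    koszul I X Y Z p - koszul I Y X Z p = ⟪VectorField.mlieBracket I X Y p, Z p⟫ := by
  rw [koszul, koszul, mvfderiv_inner_comm (X := Y) (Y := X),
    VectorField.mlieBracket_swap_apply (V := Y) (W := X),
    VectorField.mlieBracket_swap_apply (V := Z) (W := Y),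
    VectorField.mlieBracket_swap_apply (V := X) (W := Z)]
  simp only [inner_neg_left]
  ring

/-- `X ⟪Y, Z⟫ = ⟪∇_X Y, Z⟫ + ⟪Y, ∇_X Z⟫`. -/
theorem koszul_add_swap :
    koszul I X Y Z p + koszul I X Z Y p = mvfderiv I (fun q ↦ ⟪Y q, Z q⟫) p (X p) := by
  rw [koszul, koszul, mvfderiv_inner_comm (X := Z) (Y := Y),
    VectorField.mlieBracket_swap_apply (V := Z) (W := X),
    VectorField.mlieBracket_swap_apply (V := Z) (W := Y),
    VectorField.mlieBracket_swap_apply (V := Y) (W := X)]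
  simp only [inner_neg_left]
  ring

theorem koszul_smul_trd (hX : MDiffAt (T% X) p) (hY : MDiffAt (T% Y) p) (hZ : MDiffAt (T% Z) p)
    (hf : MDiffAt f p) : koszul I X Y (f • Z) p = f p * koszul I X Y Z p := by
  have h1 := koszul_smul_snd hX hZ hY hf
  have h2 := koszul_add_swap (I := I) (X := X) (Y := Y) (Z := Z) (p := p)
  have h3 := koszul_add_swap (I := I) (X := X) (Y := f • Z) (Z := Y) (p := p)
  have h4 := mvfderiv_inner_smul hZ hY hf (X p)
  have h5 := mvfderiv_inner_comm (I := I) (X := Y) (Y := Z) (p := p) (X p)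
  simp [inner_smul_left] at h3
  rw [h4] at h3
  linear_combination h3 - h1 - f p * h2 - f p * h5

theorem koszul_add_trd (hX : MDiffAt (T% X) p) (hY : MDiffAt (T% Y) p)
    (hZ : MDiffAt (T% Z) p) (hZ' : MDiffAt (T% Z') p) :
    koszul I X Y (Z + Z') p = koszul I X Y Z p + koszul I X Y Z' p := by
  have h1 := koszul_add_snd hX hZ hZ' hY
  have h2 := koszul_add_swap (I := I) (X := X) (Y := Z) (Z := Y) (p := p)
  have h2' := koszul_add_swap (I := I) (X := X) (Y := Z') (Z := Y) (p := p)
  have h3 := koszul_add_swap (I := I) (X := X) (Y := Z + Z') (Z := Y) (p := p)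
  have h4 := mvfderiv_inner_add hZ hZ' hY (X p)
  simp [inner_add_left] at h3
  rw [h4] at h3
  linear_combination h3 - h1 - h2 - h2'

theorem tensorialAt_koszul_fst (hY : MDiffAt (T% Y) p) (hZ : MDiffAt (T% Z) p) :
    TensorialAt I E (fun X ↦ koszul I X Y Z p) p where
  smul hf hX := koszul_smul_fst hX hY hZ hf
  add hX hX' := koszul_add_fst hX hX' hY hZ

theorem tensorialAt_koszul_trd (hX : MDiffAt (T% X) p) (hY : MDiffAt (T% Y) p) :
    TensorialAt I E (fun Z ↦ koszul I X Y Z p) p where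
  smul hf hZ := koszul_smul_trd hX hY hZ hf
  add hZ hZ' := koszul_add_trd hX hY hZ hZ'

/-- For `Y` differentiable at `p`, the bilinear form `(X, Z) ↦ ⟪∇_X Y, Z⟫` on the tangent space
at `p` that is given by the Koszul formula. -/
def koszulForm (Y : Π p : M, TangentSpace I p) (p : M) (hY : MDiffAt (T% Y) p) :
    TangentSpace I p →L[ℝ] TangentSpace I p →L[ℝ] ℝ :=
  TensorialAt.mkHom₂ (fun X Z ↦ koszul I X Y Z p) p
    (fun _ hZ ↦ tensorialAt_koszul_fst hY hZ) (fun _ hX ↦ tensorialAt_koszul_trd hX hY)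

theorem koszulForm_apply (hX : MDiffAt (T% X) p) (hY : MDiffAt (T% Y) p)
    (hZ : MDiffAt (T% Z) p) : koszulForm Y p hY (X p) (Z p) = koszul I X Y Z p :=
  TensorialAt.mkHom₂_apply (Φ := fun X Z ↦ koszul I X Y Z p) _ _ hX hZ

instance (p : M) : FiniteDimensional ℝ (TangentSpace I p) := inferInstanceAs (FiniteDimensional ℝ E)

open Classical in
/-- The endomorphism `X ↦ ∇_X Y` of the tangent space at `p` determined by
`⟪∇_X Y, Z⟫ = koszul X Y Z` (with the junk value `0` if `Y` is not differentiable at `p`). -/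
def leviCivitaFun (Y : Π p : M, TangentSpace I p) (p : M) :
    TangentSpace I p →L[ℝ] TangentSpace I p :=
  if hY : MDiffAt (T% Y) p then
    ∑ i, ((koszulForm Y p hY).flip (stdOrthonormalBasis ℝ (TangentSpace I p) i)).smulRight
      (stdOrthonormalBasis ℝ (TangentSpace I p) i)
  else 0

theorem inner_leviCivitaFun (hX : MDiffAt (T% X) p) (hY : MDiffAt (T% Y) p)
    (hZ : MDiffAt (T% Z) p) : ⟪leviCivitaFun Y p (X p), Z p⟫ = koszul I X Y Z p := by
  rw [← koszulForm_apply hX hY hZ]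
  conv_rhs => rw [← (stdOrthonormalBasis ℝ (TangentSpace I p)).sum_repr' (Z p)]
  simp [leviCivitaFun, hY, sum_inner, inner_smul_left, mul_comm]

theorem exists_field (x : TangentSpace I p) :
    ∃ X : Π p : M, TangentSpace I p, MDiffAt (T% X) p ∧ X p = x :=
  ⟨FiberBundle.extend E x, FiberBundle.mdifferentiableAt_extend I E x, by simp⟩

theorem leviCivitaFun_ext {v w : TangentSpace I p}
    (h : ∀ Z : Π p : M, TangentSpace I p, MDiffAt (T% Z) p → ⟪v, Z p⟫ = ⟪w, Z p⟫) : v = w := by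
  refine ext_inner_right ℝ fun z ↦ ?_
  obtain ⟨Z, hZ, rfl⟩ := exists_field z
  exact h Z hZ

variable (I M) in
/-- The Levi-Civita connection of a Riemannian manifold. -/
def leviCivita : CovariantDerivative I E (TangentSpace I : M → Type _) where
  toFun := leviCivitaFun
  isCovariantDerivativeOnUniv :=
    { add := by
        intro Y Y' p hY hY' _
        ext x
        refine leviCivitaFun_ext fun Z hZ ↦ ?_
        obtain ⟨X, hX, rfl⟩ := exists_field x
        rw [add_apply, inner_add_left,
          inner_leviCivitaFun hX hY hZ, inner_leviCivitaFun hX hY' hZ,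
          inner_leviCivitaFun hX (mdifferentiableAt_add_section hY hY') hZ,
          koszul_add_snd hX hY hY' hZ]
      leibniz := by
        intro Y f p hY hf _
        ext x
        refine leviCivitaFun_ext fun Z hZ ↦ ?_
        obtain ⟨X, hX, rfl⟩ := exists_field x
        rw [inner_leviCivitaFun hX (hf.smul_section hY) hZ, koszul_smul_snd hX hY hZ hf,
          ← inner_leviCivitaFun hX hY hZ]
        simp [inner_add_left, inner_smul_left] }

theorem leviCivita_torsion [CompleteSpace E] : (leviCivita I M).torsion = 0 := by
  rw [CovariantDerivative.torsion_eq_zero_iff]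
  intro X Y p hX hY
  refine leviCivitaFun_ext fun Z hZ ↦ ?_
  rw [inner_sub_left]
  exact (congrArg₂ (· - ·) (inner_leviCivitaFun hX hY hZ) (inner_leviCivitaFun hY hX hZ)).trans
    koszul_sub_swap

theorem leviCivita_metric (hX : MDiffAt (T% X) p) (hY : MDiffAt (T% Y) p)
    (hZ : MDiffAt (T% Z) p) : mvfderiv I (fun q ↦ ⟪Y q, Z q⟫) p (X p) =
      ⟪leviCivita I M Y p (X p), Z p⟫ + ⟪Y p, leviCivita I M Z p (X p)⟫ := by
  rw [← koszul_add_swap, ← inner_leviCivitaFun hX hY hZ, ← inner_leviCivitaFun hX hZ hY,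
    real_inner_comm (Y p)]
  rfl

end LeviCivita

/-! ### Differential forms -/

section Forms

variable {n : ℕ} {M : Type*} [TopologicalSpace M] [ChartedSpace (EuclideanSpace ℝ (Fin n)) M]
  [IsManifold (𝓡 n) ∞ M]

/-- The exterior derivative of a differential form on a manifold: the value at `p` is the exterior
derivative of the expression of the form in the chart at `p`. -/
def extDer {k : ℕ} (α : Π p : M, TangentSpace (𝓡 n) p [⋀^Fin k]→L[ℝ] ℝ) (p : M) :
    TangentSpace (𝓡 n) p [⋀^Fin (k + 1)]→L[ℝ] ℝ :=
  (extDeriv (fun y : EuclideanSpace ℝ (Fin n) ↦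
      (α ((extChartAt (𝓡 n) p).symm y)).compContinuousLinearMap
        (mfderiv 𝓘(ℝ, EuclideanSpace ℝ (Fin n)) (𝓡 n) (extChartAt (𝓡 n) p).symm y))
    (extChartAt (𝓡 n) p p)).compContinuousLinearMap
      (mfderiv (𝓡 n) 𝓘(ℝ, EuclideanSpace ℝ (Fin n)) (extChartAt (𝓡 n) p) p)

/-- The covariant derivative of a differential form `α` in the direction of `X`:
`(∇_X α)(Y₁, …, Yₖ) = X (α(Y₁, …, Yₖ)) - ∑ i, α(Y₁, …, ∇_X Yᵢ, …, Yₖ)`. -/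
def covDerForm (cov : CovariantDerivative (𝓡 n) (EuclideanSpace ℝ (Fin n))
      (TangentSpace (𝓡 n) : M → Type _)) {k : ℕ}
    (α : Π p : M, TangentSpace (𝓡 n) p [⋀^Fin k]→L[ℝ] ℝ) (X : Π p : M, TangentSpace (𝓡 n) p)
    (Y : Fin k → Π p : M, TangentSpace (𝓡 n) p) (p : M) : ℝ :=
  mvfderiv (𝓡 n) (fun q ↦ α q (fun i ↦ Y i q)) p (X p)
    - ∑ i, α p (Function.update (fun j ↦ Y j p) i (cov (Y i) p (X p)))

end Forms

/-! ### `Spin(7)` structures -/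

section Structures

instance {n : ℕ} {M : Type*} [TopologicalSpace M] [ChartedSpace (EuclideanSpace ℝ (Fin n)) M]
    (p : M) : Fact (finrank ℝ (TangentSpace (𝓡 n) p) = n) :=
  ⟨finrank_euclideanSpace_fin (𝕜 := ℝ) (n := n)⟩

variable (M : Type*) [TopologicalSpace M] [ChartedSpace (EuclideanSpace ℝ (Fin 8)) M]
  [IsManifold (𝓡 8) ∞ M] [RiemannianBundle (TangentSpace (𝓡 8) : M → Type _)]

/-- A `Spin(7)` structure on a Riemannian 8-manifold: a 4-form (the fundamental form) which near
every point is the standard form in some smooth orthonormal frame, together with the orientation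
for which these frames are positively oriented. -/
structure Spin7Structure where
  /-- The fundamental form. -/
  form : Π p : M, TangentSpace (𝓡 8) p [⋀^Fin 4]→L[ℝ] ℝ
  /-- The orientation of the tangent spaces. -/
  orientation : Π p : M, Orientation ℝ (TangentSpace (𝓡 8) p) (Fin 8)
  exists_frame : ∀ p : M, ∃ U : Set M, IsOpen U ∧ p ∈ U ∧
    ∃ e : Π q : M, OrthonormalBasis (Fin 8) ℝ (TangentSpace (𝓡 8) q),
      (∀ i, ContMDiffOn (𝓡 8) (𝓡 8).tangent ∞
        (fun q ↦ (⟨q, e q i⟩ : TangentBundle (𝓡 8) M)) U) ∧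
      ∀ q ∈ U, (e q).toBasis.orientation = orientation q ∧
        ∀ v : Fin 4 → TangentSpace (𝓡 8) q,
          form q v = standardForm (fun a i ↦ ⟪e q i, v a⟫)

variable {M}

namespace Spin7Structure

/-- The Hodge star on differential forms of an 8-manifold with a `Spin(7)` structure. -/
def star (S : Spin7Structure M) {k l : ℕ} (h : k + l = 8)
    (α : Π p : M, TangentSpace (𝓡 8) p [⋀^Fin k]→L[ℝ] ℝ) (p : M) :
    TangentSpace (𝓡 8) p [⋀^Fin l]→L[ℝ] ℝ :=
  hodgeStar (S.orientation p) h (α p)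

/-- `δΦ = -⋆d⋆Φ`. -/
def codiffForm (S : Spin7Structure M) : Π p : M, TangentSpace (𝓡 8) p [⋀^Fin 3]→L[ℝ] ℝ :=
  fun p ↦ -S.star (k := 5) (l := 3) rfl (extDer (S.star (k := 4) (l := 4) rfl S.form)) p

/-- The 1-form `⋆(δΦ ∧ Φ)`. -/
def starCodiffWedge (S : Spin7Structure M) (p : M) (v : TangentSpace (𝓡 8) p) : ℝ :=
  S.star (k := 3 + 4) (l := 1) rfl (fun q ↦ wedge (S.codiffForm q) (S.form q)) p ![v]

/-- The threefold vector cross product `P` on the tangent spaces, `⟪P(x, y, z), t⟫ = Φ(x, y, z, t)`. -/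
def cross (S : Spin7Structure M) {p : M} (x y z : TangentSpace (𝓡 8) p) : TangentSpace (𝓡 8) p :=
  crossProduct (S.form p) x y z

end Spin7Structure

end Structures

end Spin7

end

set_option linter.unusedSectionVars false

noncomputable section

namespace Spin7

/-! ### Integer tables -/

section Tables

/-! The identity is pointwise linear algebra once `∇Φ` and `δΦ` are expressed through the connection
form of an adapted orthonormal frame.

In a frame where `Φ` has constant coefficients, `∇_X Φ` is the infinitesimal action on `Φ` of the
skew matrix `ω(X) = (⟪∇_X e_i, e_j⟫)`. The stabilizer of `Φ` is `spin(7)`, so only the component of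
`ω(X)` in the 7-dimensional complement of `spin(7)` in `so(8)` counts. That component is recorded by
numbers `t(X, r)`, `r = 1, …, 7` (`transversePart`), and `∇_X Φ` has coefficients `quadSign b c d f
* t(X, b ^^^ c ^^^ d ^^^ f)` (`coframeVariation_basis`). Both `Φ` and these variations are self-dual
(`hodgeStar_eq_self`).

Because the Levi-Civita connection has no torsion, `dΦ` is the alternation of `∇Φ`
(`extDer_eq_sum_coframeVariation`). Self-duality, used once to replace `d⋆Φ` by `dΦ` and once inside
`⋆(e^a ∧ ∇_{e_a} Φ) = ι_{e_a} ⋆∇_{e_a} Φ`, gives `δΦ = -∑ ι_{e_a} ∇_{e_a} Φ`. So `δΦ` is an explicit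
linear function of the `8 · 7 = 56` numbers `t(e_a, r)`, and `dim Λ³ = 56` as well. `transverse_eq`
inverts this function: `t(X, ·)` is also the transverse part of the skew form `C(u, v) = -(½ δΦ(X,
u, v) - ¹⁄₁₂ ⋆(δΦ ∧ Φ)(P(X, u, v)))`. Replacing `ω(X)` by `C` does not change the action on `Φ`, and
the action of `C` on the four slots of `Φ` is the right-hand side
(`coframeVariation_eq_codifferential`).

The algebra is made finite by indexing the basis with `(ℤ/2)³`, that is, `Fin 8` under xor. Clifford
multiplication then permutes the basis spinors up to sign, `Φ(a, b, c, d)` is the diagonal matrix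
coefficient of `e_a e_b e_c e_d` at a fixed spinor up to an overall sign, and every identity becomes
a check on signs. -/

/-- The structure signs of Clifford multiplication `e_a · e_b = ± e_{a ^^^ b}` on the spinor spaces,
both identified with `ℝ⁸`. -/
def cliffordSign (a b : Fin 8) : ℤ :=
  if Nat.testBit 0xb2e42e78ca9c5600 (8 * a.val + b.val) then -1 else 1

/-- The sign of the action of `e_a e_b e_c e_d` on the distinguished spinor `e_0`; it is `0` if two
of the indices agree. -/
def quadSign (a b c d : Fin 8) : ℤ :=
  if a = b ∨ a = c ∨ a = d ∨ b = c ∨ b = d ∨ c = d then 0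
  else -(cliffordSign a (a ^^^ b ^^^ c ^^^ d) * cliffordSign b (c ^^^ d) *
    cliffordSign c (c ^^^ d) * cliffordSign d 0)

/-- The coefficients of the standard `Spin(7)` form. -/
def formCoeff (a b c d : Fin 8) : ℤ :=
  if a ^^^ b ^^^ c ^^^ d = 0 then quadSign a b c d else 0

/-- The coefficients of the seven 2-forms that span the orthogonal complement of `spin(7)` in `Λ²`:
the form with label `r ≠ 0` is `½ ∑ m, e_m ∧ e_{m ^^^ r}` with these signs. -/
def pairSign (m r : Fin 8) : ℤ :=
  if r = 0 then 0 else if m = 0 then -1 else cliffordSign m (m ^^^ r)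

/-- The value of the monomial form `e_i ∧ e_j ∧ e_k` on basis vectors. -/
def detThree (i j k b c d : Fin 8) : ℤ :=
  (if b = i then (if c = j then (if d = k then 1 else 0) else 0) -
      (if c = k then (if d = j then 1 else 0) else 0) else 0)
    - (if b = j then (if c = i then (if d = k then 1 else 0) else 0) -
      (if c = k then (if d = i then 1 else 0) else 0) else 0)
    + (if b = k then (if c = i then (if d = j then 1 else 0) else 0) -
      (if c = j then (if d = i then 1 else 0) else 0) else 0)

/-- The value of the monomial form `e_i ∧ e_j ∧ e_k ∧ e_l` on basis vectors. -/
def detFour (i j k l a b c d : Fin 8) : ℤ :=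
  (if a = i then detThree j k l b c d else 0) - (if a = j then detThree i k l b c d else 0)
    + (if a = k then detThree i j l b c d else 0) - (if a = l then detThree i j k b c d else 0)

/-! ### Xor on the indices, and skew-symmetry of the sign tables -/

instance : LawfulXor (Fin 8) := inferInstanceAs (LawfulXor (Fin (2 ^ 3)))

theorem fin8_xor_left_comm (a b c : Fin 8) : a ^^^ (b ^^^ c) = b ^^^ (a ^^^ c) := by
  rw [← xor_assoc, LawfulXor.xor_comm a, xor_assoc]

theorem fin8_xor_swap_fst (a b c d : Fin 8) : b ^^^ a ^^^ c ^^^ d = a ^^^ b ^^^ c ^^^ d := by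
  rw [LawfulXor.xor_comm b]

theorem fin8_xor_swap_snd (a b c d : Fin 8) : a ^^^ c ^^^ b ^^^ d = a ^^^ b ^^^ c ^^^ d := by
  simp only [xor_assoc, fin8_xor_left_comm]

theorem fin8_xor_swap_trd (a b c d : Fin 8) : a ^^^ b ^^^ d ^^^ c = a ^^^ b ^^^ c ^^^ d := by
  rw [xor_assoc, LawfulXor.xor_comm d, ← xor_assoc]

/-- The Clifford relation `e_a e_b = -e_b e_a` on the spinor space that contains the distinguished
spinor. The right factor maps this space to the other one by the table, and the left factor maps
back by the transposed table, so its sign is read at the target index. -/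
theorem cliffordSign_swap_even (a b y : Fin 8) (h : a ≠ b) :
    cliffordSign a (a ^^^ b ^^^ y) * cliffordSign b y
      = -(cliffordSign b (a ^^^ b ^^^ y) * cliffordSign a y) := by
  revert a b y
  decide +kernel

/-- The same anticommutation on the other spinor space, where the transposed table acts first. -/
theorem cliffordSign_swap_odd (a b y : Fin 8) (h : a ≠ b) :
    cliffordSign a (b ^^^ y) * cliffordSign b (b ^^^ y)
      = -(cliffordSign b (a ^^^ y) * cliffordSign a (a ^^^ y)) := by
  revert a b y
  decide +kernel

/-- Swapping neighbours in `e_a e_b e_c e_d` is one Clifford anticommutation. It takes place on the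
even space for the outer pairs and on the odd space for the middle pair. -/
theorem quadSign_swap_fst (a b c d : Fin 8) : quadSign b a c d = -quadSign a b c d := by
  unfold quadSign
  split_ifs with h1 h2 h2
  · simp
  · grind
  · grind
  · have h := cliffordSign_swap_even a b (c ^^^ d) (by grind)
    simp only [← xor_assoc] at h
    rw [fin8_xor_swap_fst]
    linear_combination -(cliffordSign c (c ^^^ d) * cliffordSign d 0) * h

theorem quadSign_swap_snd (a b c d : Fin 8) : quadSign a c b d = -quadSign a b c d := by
  unfold quadSign
  split_ifs with h1 h2 h2
  · simp
  · grind
  · grind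
  · have h := cliffordSign_swap_odd b c d (by grind)
    rw [fin8_xor_swap_snd]
    linear_combination -(cliffordSign a (a ^^^ b ^^^ c ^^^ d) * cliffordSign d 0) * h

theorem quadSign_swap_trd (a b c d : Fin 8) : quadSign a b d c = -quadSign a b c d := by
  unfold quadSign
  split_ifs with h1 h2 h2
  · simp
  · grind
  · grind
  · have h := cliffordSign_swap_even c d 0 (by grind)
    rw [xor_zero] at h
    rw [fin8_xor_swap_trd, LawfulXor.xor_comm d]
    linear_combination -(cliffordSign a (a ^^^ b ^^^ c ^^^ d) * cliffordSign b (c ^^^ d)) * h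

theorem formCoeff_swap_fst (a b c d : Fin 8) : formCoeff b a c d = -formCoeff a b c d := by
  rw [formCoeff, formCoeff, fin8_xor_swap_fst, quadSign_swap_fst]
  split_ifs <;> simp

theorem formCoeff_swap_snd (a b c d : Fin 8) : formCoeff a c b d = -formCoeff a b c d := by
  rw [formCoeff, formCoeff, fin8_xor_swap_snd, quadSign_swap_snd]
  split_ifs <;> simp

theorem formCoeff_swap_trd (a b c d : Fin 8) : formCoeff a b d c = -formCoeff a b c d := by
  rw [formCoeff, formCoeff, fin8_xor_swap_trd, quadSign_swap_trd]
  split_ifs <;> simp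

/-- A property of tuples that is preserved by swapping neighbours holds if it holds for monotone
tuples. -/
theorem forall_tuple_of_monotone {n : ℕ} {α : Type*} [LinearOrder α] {P : (Fin (n + 1) → α) → Prop}
    (hswap : ∀ w (i : Fin n), P w → P (w ∘ Equiv.swap i.castSucc i.succ))
    (h : ∀ w, Monotone w → P w) (w : Fin (n + 1) → α) : P w := by
  have hperm : ∀ σ : Equiv.Perm (Fin (n + 1)), ∀ w, P w → P (w ∘ σ) := by
    intro σ
    have hσ : σ ∈ Submonoid.closure (Set.range fun i : Fin n ↦ Equiv.swap i.castSucc i.succ) := by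
      rw [Equiv.Perm.mclosure_swap_castSucc_succ]
      trivial
    induction hσ using Submonoid.closure_induction with
    | mem σ hσ =>
      obtain ⟨i, rfl⟩ := hσ
      exact fun w hw ↦ hswap w i hw
    | one => exact fun w hw ↦ hw
    | mul σ τ _ _ h₁ h₂ => exact fun w hw ↦ h₂ _ (h₁ w hw)
  have hw := hperm (Tuple.sort w)⁻¹ _ (h _ (Tuple.monotone_sort w))
  rwa [Function.comp_assoc, ← Equiv.Perm.coe_mul, mul_inv_cancel, Equiv.Perm.coe_one,
    Function.comp_id] at hw

theorem forall_quadruple_of_sorted {P : Fin 8 → Fin 8 → Fin 8 → Fin 8 → Prop}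
    (h₁ : ∀ a b c d, P a b c d → P b a c d) (h₂ : ∀ a b c d, P a b c d → P a c b d)
    (h₃ : ∀ a b c d, P a b c d → P a b d c)
    (h : ∀ a b, a ≤ b → ∀ c, b ≤ c → ∀ d, c ≤ d → P a b c d) (a b c d : Fin 8) : P a b c d := by
  refine forall_tuple_of_monotone (P := fun w : Fin 4 → Fin 8 ↦ P (w 0) (w 1) (w 2) (w 3))
    (fun w i hw ↦ ?_) (fun w hw ↦ ?_) ![a, b, c, d]
  · fin_cases i
    exacts [h₁ _ _ _ _ hw, h₂ _ _ _ _ hw, h₃ _ _ _ _ hw]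
  · exact h _ _ (hw (by decide)) _ (hw (by decide)) _ (hw (by decide))

/-- Both sides are alternating, so the sorted quadruples suffice; restricting to them keeps the
kernel check small. -/
theorem formCoeff_eq (a b c d : Fin 8) (hab : a ≤ b) (hbc : b ≤ c) (hcd : c ≤ d) :
    formCoeff a b c d =
      detFour 0 1 2 3 a b c d + detFour 0 1 4 5 a b c d + detFour 0 1 6 7 a b c d
      + detFour 0 2 4 6 a b c d - detFour 0 2 5 7 a b c d - detFour 0 3 4 7 a b c d
      - detFour 0 3 5 6 a b c d + detFour 4 5 6 7 a b c d + detFour 2 3 6 7 a b c d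
      + detFour 2 3 4 5 a b c d + detFour 1 3 5 7 a b c d - detFour 1 3 4 6 a b c d
      - detFour 1 2 4 7 a b c d - detFour 1 2 5 6 a b c d := by
  have h : ∀ a b : Fin 8, a ≤ b → ∀ c, b ≤ c → ∀ d, c ≤ d → formCoeff a b c d =
      detFour 0 1 2 3 a b c d + detFour 0 1 4 5 a b c d + detFour 0 1 6 7 a b c d
      + detFour 0 2 4 6 a b c d - detFour 0 2 5 7 a b c d - detFour 0 3 4 7 a b c d
      - detFour 0 3 5 6 a b c d + detFour 4 5 6 7 a b c d + detFour 2 3 6 7 a b c d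
      + detFour 2 3 4 5 a b c d + detFour 1 3 5 7 a b c d - detFour 1 3 4 6 a b c d
      - detFour 1 2 4 7 a b c d - detFour 1 2 5 6 a b c d := by
    decide +kernel
  exact h a b hab c hbc d hcd

/-- The action of the elementary matrix that sends `e_m` to `e_{m ^^^ r}` on the standard form. -/
def elementaryAction (m r b c d e : Fin 8) : ℤ :=
  (if m ^^^ r = b then formCoeff m c d e else 0) + (if m ^^^ r = c then formCoeff b m d e else 0)
    + (if m ^^^ r = d then formCoeff b c m e else 0) + (if m ^^^ r = e then formCoeff b c d m else 0)

theorem elementaryAction_swap_fst (m r b c d e : Fin 8) :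
    elementaryAction m r c b d e = -elementaryAction m r b c d e := by
  simp only [elementaryAction]
  rw [formCoeff_swap_fst m c, formCoeff_swap_fst b m, formCoeff_swap_fst b c m,
    formCoeff_swap_fst b c d]
  split_ifs <;> ring

theorem elementaryAction_swap_snd (m r b c d e : Fin 8) :
    elementaryAction m r b d c e = -elementaryAction m r b c d e := by
  simp only [elementaryAction]
  rw [formCoeff_swap_snd m c, formCoeff_swap_snd b m, formCoeff_swap_snd b c m,
    formCoeff_swap_snd b c d]
  split_ifs <;> ring

theorem elementaryAction_swap_trd (m r b c d e : Fin 8) :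
    elementaryAction m r b c e d = -elementaryAction m r b c d e := by
  simp only [elementaryAction]
  rw [formCoeff_swap_trd m c, formCoeff_swap_trd b m, formCoeff_swap_trd b c m,
    formCoeff_swap_trd b c d]
  split_ifs <;> ring

/-- The elementary rotation in the plane of `e_m` and `e_{m ^^^ r}` acts on `Φ` only through its
component along the `r`-th 2-form of the complement of `spin(7)`; the result has the coefficients
`quadSign`, restricted to quadruples with xor `r`. Both sides alternate in the four form indices,
which allows the reduction to sorted ones. -/
theorem elementaryAction_sub (m b c d e : Fin 8) :
    elementaryAction m (b ^^^ c ^^^ d ^^^ e) b c d e -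
      elementaryAction (m ^^^ (b ^^^ c ^^^ d ^^^ e)) (b ^^^ c ^^^ d ^^^ e) b c d e =
        quadSign b c d e * pairSign m (b ^^^ c ^^^ d ^^^ e) := by
  refine forall_quadruple_of_sorted (P := fun b c d e ↦
    elementaryAction m (b ^^^ c ^^^ d ^^^ e) b c d e -
      elementaryAction (m ^^^ (b ^^^ c ^^^ d ^^^ e)) (b ^^^ c ^^^ d ^^^ e) b c d e =
        quadSign b c d e * pairSign m (b ^^^ c ^^^ d ^^^ e))
    (fun b c d e h ↦ ?_) (fun b c d e h ↦ ?_) (fun b c d e h ↦ ?_) ?_ b c d e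
  · rw [fin8_xor_swap_fst, elementaryAction_swap_fst m, elementaryAction_swap_fst (m ^^^ _),
      quadSign_swap_fst]
    linear_combination -h
  · rw [fin8_xor_swap_snd, elementaryAction_swap_snd m, elementaryAction_swap_snd (m ^^^ _),
      quadSign_swap_snd]
    linear_combination -h
  · rw [fin8_xor_swap_trd, elementaryAction_swap_trd m, elementaryAction_swap_trd (m ^^^ _),
      quadSign_swap_trd]
    linear_combination -h
  · clear b c d e
    revert m
    decide +kernel

/-- Contracting a variation of `Φ` with `Φ` in three slots returns a multiple of the generating
2-form. The diagonal must be excluded: for `i = n` each of the 42 nonzero terms is `-1`, while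
`pairSign i 0 = 0`. -/
theorem sum_quadSign_mul_formCoeff (i n : Fin 8) (h : i ≠ n) :
    ∑ x, ∑ y, ∑ z, quadSign i x y z * formCoeff x y z n = 24 * pairSign i (i ^^^ n) := by
  revert i n
  decide +kernel

/-- The sign identity that inverts the passage from transverse parts to `δΦ`. The excluded index `i
= a ^^^ s` is the one that gets multiplied by a transverse part with label `0`, which vanishes. -/
theorem sum_pairSign_mul (a s i : Fin 8) (h : i ≠ a ^^^ s) :
    ∑ m, pairSign m s * (-3 * quadSign i a (m ^^^ s) m
      + 2 * formCoeff a (m ^^^ s) m (a ^^^ s) * pairSign i (i ^^^ (a ^^^ s))) =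
        if i = a then -12 else 0 := by
  revert a s i
  decide +kernel

end Tables

/-! ### The Hodge star in an orthonormal basis -/

section Hodge

variable {V : Type*} [NormedAddCommGroup V] [InnerProductSpace ℝ V] [FiniteDimensional ℝ V]

/-- Expanding `F` on `b` in terms of `e`, and `G` on `e` in terms of `b`, produces the same
coefficients `∏ ⟪e, b⟫`, so both sides are one double sum. This frees the Hodge star from the
standard basis in its definition. -/
theorem sum_apply_mul_apply_orthonormalBasis {ι κ κ' : Type*} [Fintype ι] [DecidableEq ι]
    [Fintype κ] [Fintype κ'] (b : OrthonormalBasis κ ℝ V) (e : OrthonormalBasis κ' ℝ V)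
    (F G : MultilinearMap ℝ (fun _ : ι ↦ V) ℝ) :
    ∑ f : ι → κ, F (fun i ↦ b (f i)) * G (fun i ↦ b (f i)) =
      ∑ g : ι → κ', F (fun i ↦ e (g i)) * G (fun i ↦ e (g i)) := by
  have hF (f : ι → κ) : F (fun i ↦ b (f i)) =
      ∑ g : ι → κ', (∏ i, ⟪e (g i), b (f i)⟫) * F (fun i ↦ e (g i)) := by
    conv_lhs => rw [show (fun i ↦ b (f i)) = fun i ↦ ∑ j, ⟪e j, b (f i)⟫ • e j from
      funext fun i ↦ (e.sum_repr' (b (f i))).symm]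
    rw [F.map_sum]
    exact Finset.sum_congr rfl fun g _ ↦ by rw [F.map_smul_univ, smul_eq_mul]
  have hG (g : ι → κ') : G (fun i ↦ e (g i)) =
      ∑ f : ι → κ, (∏ i, ⟪e (g i), b (f i)⟫) * G (fun i ↦ b (f i)) := by
    conv_lhs => rw [show (fun i ↦ e (g i)) = fun i ↦ ∑ j, ⟪e (g i), b j⟫ • b j from
      funext fun i ↦ by simp_rw [real_inner_comm _ (e (g i))]; exact (b.sum_repr' (e (g i))).symm]
    rw [G.map_sum]
    exact Finset.sum_congr rfl fun f _ ↦ by rw [G.map_smul_univ, smul_eq_mul]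
  simp_rw [hF, hG, Finset.sum_mul, Finset.mul_sum]
  rw [Finset.sum_comm]
  exact Finset.sum_congr rfl fun g _ ↦ Finset.sum_congr rfl fun f _ ↦ by ring

theorem append_update_left {k l n : ℕ} [DecidableEq (Fin k)] (h : k + l = n) (u : Fin k → V)
    (w : Fin l → V) (i : Fin k) (x : V) : Fin.append (Function.update u i x) w ∘ Fin.cast h.symm =
      Function.update (Fin.append u w ∘ Fin.cast h.symm) (Fin.cast h (Fin.castAdd l i)) x := by
  subst h
  funext j
  refine Fin.addCases (fun s ↦ ?_) (fun s ↦ ?_) j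
  · rcases eq_or_ne s i with rfl | hs
    · simp
    · have hne : Fin.castAdd l s ≠ Fin.castAdd l i := by simpa using hs
      simp [hs, hne]
  · have hne : Fin.natAdd k s ≠ Fin.castAdd l i := by simp [Fin.ext_iff]; omega
    simp [hne]

/-- The `k`-form `v ↦ α(v, w)` obtained from a `(k + l)`-form `α` by inserting the vectors
`w 0, …, w (l - 1)` in the last `l` slots. -/
def insertLast {k l n : ℕ} (h : k + l = n) (α : V [⋀^Fin n]→ₗ[ℝ] ℝ) (w : Fin l → V) :
    V [⋀^Fin k]→ₗ[ℝ] ℝ where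
  toFun u := α (Fin.append u w ∘ Fin.cast h.symm)
  map_update_add' := by
    intro _ u i x y
    rw [append_update_left h, append_update_left h, append_update_left h,
      AlternatingMap.map_update_add]
  map_update_smul' := by
    intro _ u i c x
    rw [append_update_left h, append_update_left h, AlternatingMap.map_update_smul]
  map_eq_zero_of_eq' := by
    intro u i j hu hij
    refine α.map_eq_zero_of_eq _ (i := Fin.cast h (Fin.castAdd l i))
      (j := Fin.cast h (Fin.castAdd l j)) ?_ ?_
    · simpa using hu
    · simpa using hij

theorem insertLast_apply {k l n : ℕ} (h : k + l = n) (α : V [⋀^Fin n]→ₗ[ℝ] ℝ) (w : Fin l → V)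
    (u : Fin k → V) : insertLast h α w u = α (Fin.append u w ∘ Fin.cast h.symm) := rfl

theorem hodgeStar_apply {k l n : ℕ} [Fact (finrank ℝ V = n)] (o : Orientation ℝ V (Fin n))
    (h : k + l = n) (α : V [⋀^Fin k]→L[ℝ] ℝ) {κ : Type*} [Fintype κ]
    (e : OrthonormalBasis κ ℝ V) (w : Fin l → V) :
    hodgeStar o h α w = (k.factorial : ℝ)⁻¹ * ∑ f : Fin k → κ,
      α (fun i ↦ e (f i)) * insertLast h o.volumeForm w (fun i ↦ e (f i)) := by
  have hs : ∀ f : Fin k → Fin (finrank ℝ V),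
      insertFirst h o.volumeForm (fun i ↦ stdOrthonormalBasis ℝ V (f i)) w =
        insertLast h o.volumeForm w (fun i ↦ stdOrthonormalBasis ℝ V (f i)) := fun _ ↦ rfl
  have := sum_apply_mul_apply_orthonormalBasis (stdOrthonormalBasis ℝ V) e
    α.toMultilinearMap (insertLast h o.volumeForm w).toMultilinearMap
  simp only [hodgeStar, ContinuousAlternatingMap.smul_apply, ContinuousAlternatingMap.sum_apply,
    hs, smul_eq_mul]
  congr 1

/-- Against an alternating map, the alternatization of a multilinear map may be replaced by the map
itself. -/
theorem sum_alternatization_mul {ι κ : Type*} [Fintype ι] [DecidableEq ι] [Fintype κ]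
    (b : κ → V) (m : MultilinearMap ℝ (fun _ : ι ↦ V) ℝ) (η : V [⋀^ι]→ₗ[ℝ] ℝ) :
    ∑ f : ι → κ, MultilinearMap.alternatization m (fun i ↦ b (f i)) * η (fun i ↦ b (f i)) =
      (Fintype.card ι).factorial * ∑ f : ι → κ, m (fun i ↦ b (f i)) * η (fun i ↦ b (f i)) := by
  simp_rw [MultilinearMap.alternatization_apply, Finset.sum_mul]
  rw [Finset.sum_comm]
  have : ∀ σ : Equiv.Perm ι, ∑ f : ι → κ,
      (Equiv.Perm.sign σ • (m.domDomCongr σ) (fun i ↦ b (f i))) * η (fun i ↦ b (f i)) =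
        ∑ f : ι → κ, m (fun i ↦ b (f i)) * η (fun i ↦ b (f i)) := by
    intro σ
    refine Fintype.sum_equiv (Equiv.arrowCongr σ.symm (Equiv.refl κ)) _ _ fun f ↦ ?_
    have h := η.map_perm (fun i ↦ b (f i)) σ
    have hm : (Equiv.Perm.sign σ • (m.domDomCongr σ) (fun i ↦ b (f i))) =
        Equiv.Perm.sign σ • m (fun i ↦ b (f (σ i))) := rfl
    have hη : η (fun i ↦ b (Equiv.arrowCongr σ.symm (Equiv.refl κ) f i)) =
        η ((fun i ↦ b (f i)) ∘ σ) := rfl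
    have hm' : m (fun i ↦ b (Equiv.arrowCongr σ.symm (Equiv.refl κ) f i)) =
        m (fun i ↦ b (f (σ i))) := rfl
    rw [hm, hη, hm', h]
    simp only [smul_mul_assoc, mul_smul_comm]
  rw [Finset.sum_congr rfl fun σ _ ↦ this σ]
  simp [Fintype.card_perm]

/-- The shuffle product and the full alternatization of the tensor product differ by the order `k!
l!` of the block permutations. The full alternatization is the easier one to sum over a basis. -/
theorem wedge_apply {k l : ℕ} (α : V [⋀^Fin k]→L[ℝ] ℝ) (β : V [⋀^Fin l]→L[ℝ] ℝ)
    (v : Fin (k + l) → V) : (k.factorial * l.factorial : ℝ) * wedge α β v =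
      MultilinearMap.alternatization
        ((LinearMap.mul' ℝ ℝ).compMultilinearMap
          (MultilinearMap.domCoprod α.toMultilinearMap β.toMultilinearMap))
        (fun i ↦ v (finSumFinEquiv i)) := by
  have h := MultilinearMap.domCoprod_alternization_eq α.toAlternatingMap β.toAlternatingMap
  have h2 := congrArg (fun γ ↦ LinearMap.mul' ℝ ℝ (γ (fun i ↦ v (finSumFinEquiv i)))) h
  simp only [Fintype.card_fin] at h2
  rw [LinearMap.compMultilinearMap_alternatization]
  refine Eq.trans ?_ h2.symm
  rw [AlternatingMap.smul_apply, map_nsmul, nsmul_eq_mul]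
  push_cast
  rfl

theorem sum_wedge_mul {k l : ℕ} {κ : Type*} [Fintype κ] (b : κ → V) (α : V [⋀^Fin k]→L[ℝ] ℝ)
    (β : V [⋀^Fin l]→L[ℝ] ℝ) (η : V [⋀^Fin (k + l)]→ₗ[ℝ] ℝ) :
    -- The alternating factor `η` absorbs all permutations, so the wedge can be replaced by the
    -- tensor product.
    (k.factorial * l.factorial : ℝ) *
        ∑ f : Fin (k + l) → κ, wedge α β (fun i ↦ b (f i)) * η (fun i ↦ b (f i)) =
      (k + l).factorial * ∑ f : Fin k → κ, ∑ g : Fin l → κ,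
        α (fun i ↦ b (f i)) * β (fun i ↦ b (g i)) *
          η (Fin.append (fun i ↦ b (f i)) (fun i ↦ b (g i))) := by
  have h1 := sum_alternatization_mul b ((LinearMap.mul' ℝ ℝ).compMultilinearMap
          (MultilinearMap.domCoprod α.toMultilinearMap β.toMultilinearMap))
          (η.domDomCongr finSumFinEquiv.symm)
  simp only [Fintype.card_sum, Fintype.card_fin] at h1
  have h2 : ∑ f : Fin k ⊕ Fin l → κ, ((LinearMap.mul' ℝ ℝ).compMultilinearMap
      (MultilinearMap.domCoprod α.toMultilinearMap β.toMultilinearMap)) (fun i ↦ b (f i)) *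
        (η.domDomCongr finSumFinEquiv.symm) (fun i ↦ b (f i)) =
      ∑ f : Fin k → κ, ∑ g : Fin l → κ, α (fun i ↦ b (f i)) * β (fun i ↦ b (g i)) *
          η (Fin.append (fun i ↦ b (f i)) (fun i ↦ b (g i))) := by
    rw [← Fintype.sum_prod_type']
    refine Fintype.sum_equiv (Equiv.sumArrowEquivProdArrow _ _ _) _ _ fun f ↦ ?_
    have : (fun i ↦ b (f (finSumFinEquiv.symm i))) = Fin.append
        (fun i ↦ b (f (Sum.inl i))) (fun i ↦ b (f (Sum.inr i))) := by
      funext i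
      refine Fin.addCases (fun j ↦ ?_) (fun j ↦ ?_) i <;> simp
    rw [AlternatingMap.domDomCongr_apply]
    change _ * η (fun i ↦ b (f (finSumFinEquiv.symm i))) = _
    rw [this]
    rfl
  rw [← h2, ← h1, Finset.mul_sum]
  refine Fintype.sum_equiv (Equiv.arrowCongr finSumFinEquiv.symm (Equiv.refl κ)) _ _ fun f ↦ ?_
  rw [← mul_assoc, wedge_apply]
  refine congrArg₂ (· * ·) rfl (congrArg η (funext fun i ↦ ?_))
  simp

end Hodge

/-! ### Self-duality -/

section SelfDual

/-- The sign of the action of `e_a e_b ⋯ e_h` on the distinguished spinor. -/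
def volumeSign (a b c d e f g h : Fin 8) : ℤ :=
  cliffordSign a (a ^^^ (b ^^^ (c ^^^ (d ^^^ (e ^^^ (f ^^^ (g ^^^ h)))))))
    * cliffordSign b (c ^^^ (d ^^^ (e ^^^ (f ^^^ (g ^^^ h)))))
    * cliffordSign c (c ^^^ (d ^^^ (e ^^^ (f ^^^ (g ^^^ h)))))
    * cliffordSign d (e ^^^ (f ^^^ (g ^^^ h)))
    * cliffordSign e (e ^^^ (f ^^^ (g ^^^ h)))
    * cliffordSign f (g ^^^ h)
    * cliffordSign g (g ^^^ h)
    * cliffordSign h 0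

/-- One Clifford anticommutation again, on the even or the odd spinor space according to the parity
of `i`. The remaining six signs form the common factor in each `linear_combination`. -/
theorem volumeSign_swap (f : Fin 8 → Fin 8) (hf : Function.Injective f) (i : Fin 7) :
    volumeSign (f (Equiv.swap i.castSucc i.succ 0)) (f (Equiv.swap i.castSucc i.succ 1))
      (f (Equiv.swap i.castSucc i.succ 2)) (f (Equiv.swap i.castSucc i.succ 3))
      (f (Equiv.swap i.castSucc i.succ 4)) (f (Equiv.swap i.castSucc i.succ 5))
      (f (Equiv.swap i.castSucc i.succ 6)) (f (Equiv.swap i.castSucc i.succ 7)) =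
    -volumeSign (f 0) (f 1) (f 2) (f 3) (f 4) (f 5) (f 6) (f 7) := by
  have hne : ∀ a b : Fin 8, a ≠ b → f a ≠ f b := fun a b h ↦ hf.ne h
  have he := cliffordSign_swap_even
  have ho := cliffordSign_swap_odd
  simp only [xor_assoc] at he
  fin_cases i
  · change volumeSign (f 1) (f 0) (f 2) (f 3) (f 4) (f 5) (f 6) (f 7) = _
    have h := he (f 0) (f 1) (f 2 ^^^ (f 3 ^^^ (f 4 ^^^ (f 5 ^^^ (f 6 ^^^ f 7))))) (hne _ _ (by
      decide))
    simp only [volumeSign]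
    rw [fin8_xor_left_comm (f 1) (f 0)]
    linear_combination ((cliffordSign (f 2) (f 2 ^^^ (f 3 ^^^ (f 4 ^^^ (f 5 ^^^ (f 6 ^^^ f 7))))))
      * (cliffordSign (f 3) (f 4 ^^^ (f 5 ^^^ (f 6 ^^^ f 7)))) *
        (cliffordSign (f 4) (f 4 ^^^ (f 5 ^^^ (f 6 ^^^ f 7)))) *
          (cliffordSign (f 5) (f 6 ^^^ f 7)) * (cliffordSign (f 6) (f 6 ^^^ f 7)) *
            (cliffordSign (f 7) 0)) * h
  · change volumeSign (f 0) (f 2) (f 1) (f 3) (f 4) (f 5) (f 6) (f 7) = _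
    have h := ho (f 1) (f 2) (f 3 ^^^ (f 4 ^^^ (f 5 ^^^ (f 6 ^^^ f 7)))) (hne _ _ (by decide))
    simp only [volumeSign]
    rw [fin8_xor_left_comm (f 2) (f 1)]
    linear_combination ((cliffordSign (f 0) (f 0 ^^^ (f 1 ^^^ (f 2 ^^^ (f 3 ^^^ (f 4 ^^^ (f 5 ^^^
      (f 6 ^^^ f 7)))))))) * (cliffordSign (f 3) (f 4 ^^^ (f 5 ^^^ (f 6 ^^^ f 7)))) *
      (cliffordSign (f 4) (f 4 ^^^ (f 5 ^^^ (f 6 ^^^ f 7)))) *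
      (cliffordSign (f 5) (f 6 ^^^ f 7)) * (cliffordSign (f 6) (f 6 ^^^ f 7)) *
      (cliffordSign (f 7) 0)) * h
  · change volumeSign (f 0) (f 1) (f 3) (f 2) (f 4) (f 5) (f 6) (f 7) = _
    have h := he (f 2) (f 3) (f 4 ^^^ (f 5 ^^^ (f 6 ^^^ f 7))) (hne _ _ (by decide))
    simp only [volumeSign]
    rw [fin8_xor_left_comm (f 3) (f 2)]
    linear_combination ((cliffordSign (f 0) (f 0 ^^^ (f 1 ^^^ (f 2 ^^^ (f 3 ^^^ (f 4 ^^^ (f 5 ^^^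
      (f 6 ^^^ f 7)))))))) * (cliffordSign (f 1) (f 2 ^^^ (f 3 ^^^ (f 4 ^^^ (f 5 ^^^ (f 6 ^^^ f
      7)))))) * (cliffordSign (f 4) (f 4 ^^^ (f 5 ^^^ (f 6 ^^^ f 7)))) *
        (cliffordSign (f 5) (f 6 ^^^ f 7)) * (cliffordSign (f 6) (f 6 ^^^ f 7)) *
          (cliffordSign (f 7) 0)) * h
  · change volumeSign (f 0) (f 1) (f 2) (f 4) (f 3) (f 5) (f 6) (f 7) = _
    have h := ho (f 3) (f 4) (f 5 ^^^ (f 6 ^^^ f 7)) (hne _ _ (by decide))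
    simp only [volumeSign]
    rw [fin8_xor_left_comm (f 4) (f 3)]
    linear_combination ((cliffordSign (f 0) (f 0 ^^^ (f 1 ^^^ (f 2 ^^^ (f 3 ^^^ (f 4 ^^^ (f 5 ^^^
      (f 6 ^^^ f 7)))))))) * (cliffordSign (f 1) (f 2 ^^^ (f 3 ^^^ (f 4 ^^^ (f 5 ^^^ (f 6 ^^^ f
      7)))))) * (cliffordSign (f 2) (f 2 ^^^ (f 3 ^^^ (f 4 ^^^ (f 5 ^^^ (f 6 ^^^ f 7)))))) *
        (cliffordSign (f 5) (f 6 ^^^ f 7)) * (cliffordSign (f 6) (f 6 ^^^ f 7)) *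
          (cliffordSign (f 7) 0)) * h
  · change volumeSign (f 0) (f 1) (f 2) (f 3) (f 5) (f 4) (f 6) (f 7) = _
    have h := he (f 4) (f 5) (f 6 ^^^ f 7) (hne _ _ (by decide))
    simp only [volumeSign]
    rw [fin8_xor_left_comm (f 5) (f 4)]
    linear_combination ((cliffordSign (f 0) (f 0 ^^^ (f 1 ^^^ (f 2 ^^^ (f 3 ^^^ (f 4 ^^^ (f 5 ^^^
      (f 6 ^^^ f 7)))))))) * (cliffordSign (f 1) (f 2 ^^^ (f 3 ^^^ (f 4 ^^^ (f 5 ^^^ (f 6 ^^^ f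
      7)))))) * (cliffordSign (f 2) (f 2 ^^^ (f 3 ^^^ (f 4 ^^^ (f 5 ^^^ (f 6 ^^^ f 7)))))) *
        (cliffordSign (f 3) (f 4 ^^^ (f 5 ^^^ (f 6 ^^^ f 7)))) *
          (cliffordSign (f 6) (f 6 ^^^ f 7)) * (cliffordSign (f 7) 0)) * h
  · change volumeSign (f 0) (f 1) (f 2) (f 3) (f 4) (f 6) (f 5) (f 7) = _
    have h := ho (f 5) (f 6) (f 7) (hne _ _ (by decide))
    simp only [volumeSign]
    rw [fin8_xor_left_comm (f 6) (f 5)]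
    linear_combination ((cliffordSign (f 0) (f 0 ^^^ (f 1 ^^^ (f 2 ^^^ (f 3 ^^^ (f 4 ^^^ (f 5 ^^^
      (f 6 ^^^ f 7)))))))) * (cliffordSign (f 1) (f 2 ^^^ (f 3 ^^^ (f 4 ^^^ (f 5 ^^^ (f 6 ^^^ f
      7)))))) * (cliffordSign (f 2) (f 2 ^^^ (f 3 ^^^ (f 4 ^^^ (f 5 ^^^ (f 6 ^^^ f 7)))))) *
        (cliffordSign (f 3) (f 4 ^^^ (f 5 ^^^ (f 6 ^^^ f 7)))) *
          (cliffordSign (f 4) (f 4 ^^^ (f 5 ^^^ (f 6 ^^^ f 7)))) * (cliffordSign (f 7) 0)) * h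
  · change volumeSign (f 0) (f 1) (f 2) (f 3) (f 4) (f 5) (f 7) (f 6) = _
    have h := he (f 6) (f 7) 0 (hne _ _ (by decide))
    simp only [volumeSign]
    simp only [xor_zero] at h
    rw [xor_comm (f 7) (f 6)]
    linear_combination ((cliffordSign (f 0) (f 0 ^^^ (f 1 ^^^ (f 2 ^^^ (f 3 ^^^ (f 4 ^^^ (f 5 ^^^
      (f 6 ^^^ f 7)))))))) * (cliffordSign (f 1) (f 2 ^^^ (f 3 ^^^ (f 4 ^^^ (f 5 ^^^ (f 6 ^^^ f
      7)))))) * (cliffordSign (f 2) (f 2 ^^^ (f 3 ^^^ (f 4 ^^^ (f 5 ^^^ (f 6 ^^^ f 7)))))) *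
        (cliffordSign (f 3) (f 4 ^^^ (f 5 ^^^ (f 6 ^^^ f 7)))) *
          (cliffordSign (f 4) (f 4 ^^^ (f 5 ^^^ (f 6 ^^^ f 7)))) *
            (cliffordSign (f 5) (f 6 ^^^ f 7))) * h

theorem xor_comp_swap (f : Fin 8 → Fin 8) (i : Fin 7) :
    f (Equiv.swap i.castSucc i.succ 0) ^^^ (f (Equiv.swap i.castSucc i.succ 1) ^^^
      (f (Equiv.swap i.castSucc i.succ 2) ^^^ (f (Equiv.swap i.castSucc i.succ 3) ^^^
      (f (Equiv.swap i.castSucc i.succ 4) ^^^ (f (Equiv.swap i.castSucc i.succ 5) ^^^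
      (f (Equiv.swap i.castSucc i.succ 6) ^^^ f (Equiv.swap i.castSucc i.succ 7))))))) =
    f 0 ^^^ (f 1 ^^^ (f 2 ^^^ (f 3 ^^^ (f 4 ^^^ (f 5 ^^^ (f 6 ^^^ f 7)))))) := by
  fin_cases i
  · exact fin8_xor_left_comm (f 1) (f 0) _
  · exact congrArg _ (fin8_xor_left_comm (f 2) (f 1) _)
  · exact congrArg _ (congrArg _ (fin8_xor_left_comm (f 3) (f 2) _))
  · exact congrArg _ (congrArg _ (congrArg _ (fin8_xor_left_comm (f 4) (f 3) _)))
  · exact congrArg _ (congrArg _ (congrArg _ (congrArg _ (fin8_xor_left_comm (f 5) (f 4) _))))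
  · exact congrArg _ (congrArg _ (congrArg _ (congrArg _ (congrArg _
      (fin8_xor_left_comm (f 6) (f 5) _)))))
  · exact congrArg _ (congrArg _ (congrArg _ (congrArg _ (congrArg _ (congrArg _
      (xor_comm (f 7) (f 6)))))))

/-- The Clifford volume element acts as a scalar on the distinguished spinor, so reordering its
factors costs the sign of the permutation. Induction over neighbour swaps reduces the claim to the
identity, where the table is evaluated; this fixes the orientation for which `Φ` is self-dual. -/
theorem sign_eq_volumeSign (σ : Equiv.Perm (Fin 8)) :
    (Equiv.Perm.sign σ : ℤ) =
        volumeSign (σ 0) (σ 1) (σ 2) (σ 3) (σ 4) (σ 5) (σ 6) (σ 7) ∧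
      σ 0 ^^^ (σ 1 ^^^ (σ 2 ^^^ (σ 3 ^^^ (σ 4 ^^^ (σ 5 ^^^ (σ 6 ^^^ σ 7)))))) = 0 := by
  have hσ : σ ∈ Submonoid.closure (Set.range fun i : Fin 7 ↦ Equiv.swap i.castSucc i.succ) := by
    rw [Equiv.Perm.mclosure_swap_castSucc_succ]; trivial
  induction hσ using Submonoid.closure_induction_right with
  | one => exact ⟨by rw [Equiv.Perm.sign_one]; decide +kernel, by decide +kernel⟩
  | mul_right σ hσ τ hτ ih =>
    obtain ⟨i, rfl⟩ := hτ
    simp only [Equiv.Perm.mul_apply]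
    refine ⟨?_, ?_⟩
    · rw [volumeSign_swap σ σ.injective i, ← ih.1, Equiv.Perm.sign_mul,
        Equiv.Perm.sign_swap Fin.castSucc_lt_succ.ne]
      simp
    · rw [xor_comp_swap σ i, ih.2]

/-- The last four factors send the distinguished spinor to a basis spinor, and the first four send
that one back. The return sign is again `quadSign`, since reversing four anticommuting factors takes
six swaps and so the product is a symmetric matrix; this is `key`. -/
theorem volumeSign_eq_quadSign_mul (a b c d e f g h : Fin 8)
    (h₁ : a ≠ b ∧ a ≠ c ∧ a ≠ d ∧ b ≠ c ∧ b ≠ d ∧ c ≠ d)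
    (h₂ : e ≠ f ∧ e ≠ g ∧ e ≠ h ∧ f ≠ g ∧ f ≠ h ∧ g ≠ h)
    (h₃ : a ^^^ b ^^^ c ^^^ d = e ^^^ f ^^^ g ^^^ h) :
    volumeSign a b c d e f g h = quadSign a b c d * quadSign e f g h := by
  have key : ∀ a b c d : Fin 8, quadSign a b c d ≠ 0 → quadSign a b c d =
      -(cliffordSign a (a ^^^ (b ^^^ (c ^^^ (d ^^^ (a ^^^ b ^^^ c ^^^ d)))))
        * cliffordSign b (c ^^^ (d ^^^ (a ^^^ b ^^^ c ^^^ d)))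
        * cliffordSign c (c ^^^ (d ^^^ (a ^^^ b ^^^ c ^^^ d)))
        * cliffordSign d (a ^^^ b ^^^ c ^^^ d)) := by
    decide +kernel
  have hne : quadSign a b c d ≠ 0 := by
    have hk : ∀ a b : Fin 8, cliffordSign a b ≠ 0 := by decide +kernel
    simp [quadSign, h₁, hk]
  have hq : quadSign e f g h = -(cliffordSign e (e ^^^ (f ^^^ (g ^^^ h))) *
      cliffordSign f (g ^^^ h) * cliffordSign g (g ^^^ h) * cliffordSign h 0) := by
    simp [quadSign, h₂, xor_assoc]
  have hy : e ^^^ (f ^^^ (g ^^^ h)) = a ^^^ b ^^^ c ^^^ d := by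
    rw [h₃]
    simp only [xor_assoc]
  rw [key a b c d hne, hq, volumeSign, hy]
  ring

theorem quadSign_mul_self (a b c d : Fin 8)
    (h : a ≠ b ∧ a ≠ c ∧ a ≠ d ∧ b ≠ c ∧ b ≠ d ∧ c ≠ d) :
    quadSign a b c d * quadSign a b c d = 1 := by
  have hk : ∀ a b : Fin 8, cliffordSign a b * cliffordSign a b = 1 := by decide +kernel
  simp only [quadSign, h, or_self, if_false]
  linear_combination (cliffordSign b (c ^^^ d) ^ 2 * cliffordSign c (c ^^^ d) ^ 2 *
    cliffordSign d 0 ^ 2) * hk a (a ^^^ b ^^^ c ^^^ d) + (cliffordSign c (c ^^^ d) ^ 2 *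
    cliffordSign d 0 ^ 2) * hk b (c ^^^ d) + cliffordSign d 0 ^ 2 * hk c (c ^^^ d) + hk d 0

theorem injective_fin_four {α : Type*} {w : Fin 4 → α} (hw : Function.Injective w) :
    w 0 ≠ w 1 ∧ w 0 ≠ w 2 ∧ w 0 ≠ w 3 ∧ w 1 ≠ w 2 ∧ w 1 ≠ w 3 ∧ w 2 ≠ w 3 := by
  refine ⟨?_, ?_, ?_, ?_, ?_, ?_⟩ <;> exact hw.ne (by decide)

/-- These are the `4!` orderings of the complement of the image of `w`. -/
theorem card_filter_append_injective (w : Fin 4 → Fin 8) (hw : Function.Injective w) :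
    (Finset.univ.filter fun g : Fin 4 → Fin 8 ↦ Function.Injective (Fin.append g w)).card = 24 := by
  classical
  have h1 : Fintype.card {x : Fin 8 // x ∉ Finset.univ.image w} = 4 := by
    rw [Fintype.card_subtype_compl, Fintype.card_fin, Fintype.card_coe,
      Finset.card_image_of_injective _ hw, Finset.card_univ, Fintype.card_fin]
  have h2 : Fintype.card (Fin 4 ↪ {x : Fin 8 // x ∉ Finset.univ.image w}) = 24 := by
    rw [Fintype.card_embedding_eq, h1, Fintype.card_fin]; rfl
  rw [← h2, ← Fintype.card_subtype]
  refine Fintype.card_congr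
    { toFun := fun g ↦ ⟨fun i ↦ ⟨g.1 i, fun hi ↦ ?_⟩, fun i j hij ↦ ?_⟩
      invFun := fun g ↦ ⟨fun i ↦ (g i).1, ?_⟩
      left_inv := fun g ↦ rfl
      right_inv := fun g ↦ rfl }
  · obtain ⟨j, -, hj⟩ := Finset.mem_image.1 hi
    exact (Fin.append_injective_iff.1 g.2).2.2 i j hj.symm
  · exact (Fin.append_injective_iff.1 g.2).1 (Subtype.ext_iff.1 hij)
  · refine Fin.append_injective_iff.2 ⟨fun i j hij ↦ g.injective (Subtype.ext hij), hw, ?_⟩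
    intro i j hij
    exact (g i).2 (Finset.mem_image.2 ⟨j, Finset.mem_univ _, hij.symm⟩)

variable {V : Type*} [NormedAddCommGroup V] [InnerProductSpace ℝ V] [FiniteDimensional ℝ V]

/-- Forms in the span of the fundamental form and its `so(8)`-orbit are self-dual. -/
theorem hodgeStar_eq_self [Fact (finrank ℝ V = 8)] (o : Orientation ℝ V (Fin 8))
    (e : OrthonormalBasis (Fin 8) ℝ V) (he : e.toBasis.orientation = o) (ψ : V [⋀^Fin 4]→L[ℝ] ℝ)
    (t : Fin 8 → ℝ) (hψ : ∀ w : Fin 4 → Fin 8, ψ (fun i ↦ e (w i)) =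
      quadSign (w 0) (w 1) (w 2) (w 3) * t (w 0 ^^^ w 1 ^^^ w 2 ^^^ w 3)) :
    hodgeStar o (rfl : 4 + 4 = 8) ψ = ψ := by
  classical
  refine ContinuousAlternatingMap.toAlternatingMap_injective
    (e.toBasis.ext_alternating fun w hw ↦ ?_)
  simp only [OrthonormalBasis.coe_toBasis, ContinuousAlternatingMap.coe_toAlternatingMap]
  rw [hodgeStar_apply o _ ψ e]
  -- Every ordering `g` of the complementary indices contributes the same amount: the volume sign is
  -- `quadSign g * quadSign w`, the value `ψ(e_g)` supplies a second `quadSign g`, and the square is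
  -- `1`.
  have hterm : ∀ g : Fin 4 → Fin 8, ψ (fun i ↦ e (g i)) *
      insertLast (rfl : 4 + 4 = 8) o.volumeForm (fun i ↦ e (w i)) (fun i ↦ e (g i)) =
        if Function.Injective (Fin.append g w) then ψ (fun i ↦ e (w i)) else 0 := by
    intro g
    have happ : insertLast (rfl : 4 + 4 = 8) o.volumeForm (fun i ↦ e (w i)) (fun i ↦ e (g i)) =
        o.volumeForm (e ∘ Fin.append g w) := by
      rw [insertLast_apply]
      refine congrArg _ (funext fun i ↦ ?_)
      refine Fin.addCases (m := 4) (n := 4) (fun j ↦ ?_) (fun j ↦ ?_) i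
      · exact (Fin.append_left _ _ j).trans (congrArg e (Fin.append_left g w j).symm)
      · exact (Fin.append_right _ _ j).trans (congrArg e (Fin.append_right g w j).symm)
    rw [happ]
    split_ifs with hinj
    · let σ : Equiv.Perm (Fin 8) :=
        Equiv.ofBijective (Fin.append g w) (Finite.injective_iff_bijective.1 hinj)
      obtain ⟨hs, hx⟩ := sign_eq_volumeSign σ
      have hσ : (e ∘ Fin.append g w) = e.toBasis ∘ σ := by simp; rfl
      have h0 : σ 0 = g 0 := rfl
      have h1 : σ 1 = g 1 := rfl
      have h2 : σ 2 = g 2 := rfl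
      have h3 : σ 3 = g 3 := rfl
      have h4 : σ 4 = w 0 := rfl
      have h5 : σ 5 = w 1 := rfl
      have h6 : σ 6 = w 2 := rfl
      have h7 : σ 7 = w 3 := rfl
      rw [h0, h1, h2, h3, h4, h5, h6, h7] at hs hx
      have hg := injective_fin_four (Fin.append_injective_iff.1 hinj).1
      -- The xor of all eight indices is `0`, so complementary quadruples carry the same label and
      -- see the same value of `t`.
      have hxor : g 0 ^^^ g 1 ^^^ g 2 ^^^ g 3 = w 0 ^^^ w 1 ^^^ w 2 ^^^ w 3 := by
        have h : (g 0 ^^^ g 1 ^^^ g 2 ^^^ g 3) ^^^ (w 0 ^^^ w 1 ^^^ w 2 ^^^ w 3) = 0 := by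
          simpa only [xor_assoc] using hx
        rw [← xor_cancel_right (g 0 ^^^ g 1 ^^^ g 2 ^^^ g 3) (w 0 ^^^ w 1 ^^^ w 2 ^^^ w 3), h,
          zero_xor]
      rw [volumeSign_eq_quadSign_mul _ _ _ _ _ _ _ _ hg (injective_fin_four hw) hxor] at hs
      rw [o.volumeForm_robust e he, hσ, AlternatingMap.map_perm, Basis.det_self, hψ g, hψ w,
        hxor, Units.smul_def, hs, zsmul_eq_mul]
      have hq := quadSign_mul_self _ _ _ _ hg
      have hq' : (quadSign (g 0) (g 1) (g 2) (g 3) : ℝ) * quadSign (g 0) (g 1) (g 2) (g 3) = 1 :=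
        mod_cast hq
      push_cast
      linear_combination (quadSign (w 0) (w 1) (w 2) (w 3) * t (w 0 ^^^ w 1 ^^^ w 2 ^^^ w 3) : ℝ)
        * hq'
    · rw [AlternatingMap.map_eq_zero_of_not_injective, mul_zero]
      exact fun h ↦ hinj h.of_comp
  rw [Finset.sum_congr rfl fun g _ ↦ hterm g, ← Finset.sum_filter, Finset.sum_const,
    card_filter_append_injective w hw]
  simp [Nat.factorial]

end SelfDual

/-! ### The standard form and the action of `so(8)` on it -/

section Action

/-! ### The standard form on basis vectors -/

theorem cast_ite_zero (p : Prop) [Decidable p] (x : ℤ) :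
    ((if p then x else 0 : ℤ) : ℝ) = (if p then 1 else 0) * x := by
  split_ifs <;> simp

theorem detThree_eq (i j k : Fin 8) (b c d : Fin 8) :
    (detThree i j k b c d : ℝ) = Matrix.det
      !![(if b = i then 1 else 0), (if b = j then 1 else 0), (if b = k then 1 else 0);
        (if c = i then 1 else 0), (if c = j then 1 else 0), (if c = k then 1 else 0);
        (if d = i then 1 else 0), (if d = j then 1 else 0), (if d = k then (1 : ℝ) else 0)] := by
  rw [Matrix.det_fin_three]
  simp only [detThree, Int.cast_sub, Int.cast_add, cast_ite_zero, Int.cast_one, mul_one]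
  simp only [Matrix.of_apply, Matrix.cons_val', Matrix.cons_val_zero, Matrix.cons_val_one,
    Matrix.cons_val]
  ring

theorem monomial_single (i j k l : Fin 8) (w : Fin 4 → Fin 8) :
    monomial i j k l (fun s ↦ Pi.single (w s) 1) = detFour i j k l (w 0) (w 1) (w 2) (w 3) := by
  have h : monomial i j k l (fun s ↦ Pi.single (w s) 1) = Matrix.det (Matrix.of fun s t ↦
      if w s = ![i, j, k, l] t then (1 : ℝ) else 0) := by
    simp only [monomial, AlternatingMap.compLinearMap_apply]
    refine congrArg Matrix.det ?_
    ext s t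
    simp [Pi.single_apply, LinearMap.funLeft_apply, eq_comm]
  rw [h, Matrix.det_succ_row_zero, Fin.sum_univ_four]
  simp only [detFour, Int.cast_sub, Int.cast_add, cast_ite_zero, detThree_eq]
  obtain ⟨d, hd⟩ : ∃ d : Fin 4 → Fin 8 → ℝ, ∀ s t, (if w s = t then (1 : ℝ) else 0) = d s t :=
    ⟨_, fun _ _ ↦ rfl⟩
  simp only [hd, Matrix.det_fin_three]
  simp [Fin.succAbove, Matrix.submatrix_apply]
  ring

/-- This ties the Clifford sign table to the fourteen monomials: both sides alternate, and on
monotone tuples they agree by `formCoeff_eq`. -/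
theorem standardForm_single (w : Fin 4 → Fin 8) :
    standardForm (fun s ↦ Pi.single (w s) 1) = formCoeff (w 0) (w 1) (w 2) (w 3) := by
  refine forall_tuple_of_monotone (P := fun w : Fin 4 → Fin 8 ↦
    standardForm (fun s ↦ Pi.single (w s) 1) = formCoeff (w 0) (w 1) (w 2) (w 3))
    (fun w i hw ↦ ?_) (fun w hw ↦ ?_) w
  · refine (standardForm.map_swap (fun s ↦ Pi.single (w s) 1) i.castSucc_lt_succ.ne).trans ?_
    rw [hw, ← Int.cast_neg]
    refine congrArg _ ?_
    fin_cases i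
    exacts [(formCoeff_swap_fst _ _ _ _).symm, (formCoeff_swap_snd _ _ _ _).symm,
      (formCoeff_swap_trd _ _ _ _).symm]
  · rw [formCoeff_eq _ _ _ _ (hw (by decide)) (hw (by decide)) (hw (by decide))]
    simp only [standardForm, AlternatingMap.add_apply, AlternatingMap.sub_apply, monomial_single,
      Int.cast_add, Int.cast_sub]

/-- The standard `Spin(7)` form as a continuous alternating form. -/
def continuousStandardForm : (Fin 8 → ℝ) [⋀^Fin 4]→L[ℝ] ℝ where
  toMultilinearMap := standardForm.toMultilinearMap
  cont := by
    have h : ∀ i j k l, Continuous fun v : Fin 4 → Fin 8 → ℝ ↦ monomial i j k l v := by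
      intro i j k l
      change Continuous fun v : Fin 4 → Fin 8 → ℝ ↦
        Matrix.det (Matrix.of fun s t ↦ v s (![i, j, k, l] t))
      refine Continuous.matrix_det ?_
      refine continuous_pi fun s ↦ continuous_pi fun t ↦ ?_
      simp only [Matrix.of_apply]
      fun_prop
    change Continuous fun v ↦ standardForm v
    simp only [standardForm, AlternatingMap.add_apply, AlternatingMap.sub_apply]
    fun_prop (disch := exact h _ _ _ _)
  map_eq_zero_of_eq' := standardForm.map_eq_zero_of_eq'

@[simp]
theorem continuousStandardForm_apply (v : Fin 4 → Fin 8 → ℝ) :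
    continuousStandardForm v = standardForm v := rfl

variable {V : Type*} [NormedAddCommGroup V] [InnerProductSpace ℝ V] [FiniteDimensional ℝ V]

/-- The coordinates of a vector in an orthonormal basis. -/
def coframe (e : OrthonormalBasis (Fin 8) ℝ V) : V →L[ℝ] (Fin 8 → ℝ) :=
  ContinuousLinearMap.pi fun i ↦ innerSL ℝ (e i)

@[simp]
theorem coframe_apply (e : OrthonormalBasis (Fin 8) ℝ V) (v : V) (i : Fin 8) :
    coframe e v i = ⟪e i, v⟫ := rfl

theorem coframe_basis (e : OrthonormalBasis (Fin 8) ℝ V) (j : Fin 8) :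
    coframe e (e j) = Pi.single j 1 := by
  ext i
  simp [Pi.single_apply, e.inner_eq_ite]

/-- The derivative of the pullback of the standard form along the coframe `e`, in the direction of
the coframe variation `C`. -/
@[irreducible] def coframeVariation (e : OrthonormalBasis (Fin 8) ℝ V) (C : V →L[ℝ] (Fin 8 → ℝ)) :
    V [⋀^Fin 4]→L[ℝ] ℝ :=
  continuousStandardForm.fderivCompContinuousLinearMap (coframe e) C

theorem coframeVariation_apply (e : OrthonormalBasis (Fin 8) ℝ V) (C : V →L[ℝ] (Fin 8 → ℝ))
    (v : Fin 4 → V) : coframeVariation e C v =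
      ∑ s, standardForm (Function.update (fun j ↦ coframe e (v j)) s (C (v s))) := by
  rw [coframeVariation, ContinuousAlternatingMap.fderivCompContinuousLinearMap_apply]
  refine Finset.sum_congr rfl fun s _ ↦ ?_
  rw [continuousStandardForm_apply]
  refine congrArg _ (funext fun j ↦ ?_)
  rcases eq_or_ne j s with rfl | h <;> simp [*]

/-- The component of a coframe variation transverse to `spin(7)`. -/
def transversePart (e : OrthonormalBasis (Fin 8) ℝ V) (C : V →L[ℝ] (Fin 8 → ℝ)) (r : Fin 8) : ℝ :=
  (1 / 2) * ∑ m, pairSign m r * C (e (m ^^^ r)) m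

theorem standardForm_update_single (w : Fin 4 → Fin 8) (s : Fin 4) (x : Fin 8 → ℝ) :
    standardForm (Function.update (fun j ↦ Pi.single (w j) 1) s x) =
      ∑ m, x m * formCoeff (Function.update w s m 0) (Function.update w s m 1)
        (Function.update w s m 2) (Function.update w s m 3) := by
  have hx : x = ∑ m, x m • (Pi.single m 1 : Fin 8 → ℝ) := by
    ext i
    simp [Finset.sum_apply, Pi.single_apply]
  conv_lhs => rw [hx]
  rw [AlternatingMap.map_update_sum]
  refine Finset.sum_congr rfl fun m _ ↦ ?_
  rw [AlternatingMap.map_update_smul, smul_eq_mul, ← standardForm_single]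
  refine congrArg _ (congrArg _ (funext fun j ↦ ?_))
  rcases eq_or_ne j s with rfl | h <;> simp [*]

/-- Since `Φ` is supported on quadruples with xor `0`, only the entries of `C` between `e_{m ^^^ r}`
and `e_m` act, with `r` the xor of the four indices. Skewness pairs the entries for `m` and `m ^^^
r`, and `elementaryAction_sub` evaluates each pair. -/
theorem coframeVariation_basis (e : OrthonormalBasis (Fin 8) ℝ V) (C : V →L[ℝ] (Fin 8 → ℝ))
    (hC : ∀ m b, C (e b) m = -C (e m) b) (w : Fin 4 → Fin 8) :
    coframeVariation e C (fun i ↦ e (w i)) = quadSign (w 0) (w 1) (w 2) (w 3) *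
      transversePart e C (w 0 ^^^ w 1 ^^^ w 2 ^^^ w 3) := by
  rw [coframeVariation_apply]
  simp only [coframe_basis, standardForm_update_single, Fin.sum_univ_four]
  simp only [Function.update_self, ne_eq, Fin.reduceEq, not_false_eq_true, Function.update_of_ne]
  generalize w 0 = b, w 1 = c, w 2 = d, w 3 = f
  set r := b ^^^ c ^^^ d ^^^ f with hr
  -- Each slot sum has at most the one nonzero term `m = x ^^^ r`. Writing its matrix entry as `C (e
  -- (m ^^^ r)) m` lets the four slots share one sum.
  have hmul : ∀ (x : Fin 8) (φ : Fin 8 → ℤ), (∀ m, φ m ≠ 0 → m ^^^ r = x) →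
      ∑ m, C (e x) m * (φ m : ℝ) =
        ∑ m, C (e (m ^^^ r)) m * ((if m ^^^ r = x then φ m else 0 : ℤ) : ℝ) := by
    intro x φ hφ
    refine Finset.sum_congr rfl fun m _ ↦ ?_
    by_cases h : φ m = 0
    · simp [h]
    · simp [hφ m h]
  have hsupp : ∀ p q x y : Fin 8, formCoeff p q x y ≠ 0 → p ^^^ q ^^^ x ^^^ y = 0 := by
    intro p q x y h
    by_contra h'
    exact h (if_neg h')
  have hsolve : ∀ m x, m ^^^ (r ^^^ x) = 0 → m ^^^ r = x := by
    intro m x h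
    rw [← xor_assoc] at h
    rw [← xor_cancel_right (m ^^^ r) x, h, zero_xor]
  rw [hmul b, hmul c, hmul d, hmul f, ← Finset.sum_add_distrib, ← Finset.sum_add_distrib,
    ← Finset.sum_add_distrib]
  rotate_left
  iterate 4
    · intro m h
      refine hsolve _ _ ?_
      rw [← hsupp _ _ _ _ h, hr]
      simp only [LawfulXor.xor_comm, fin8_xor_left_comm, xor_cancel_left, LawfulXor.xor_self,
        xor_zero]
  have hs : ∀ φ : Fin 8 → ℝ, ∑ m, φ (m ^^^ r) = ∑ m, φ m := fun φ ↦
    Equiv.sum_comp (xor_left_involutive r).toPerm φ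
  set L : Fin 8 → ℤ := fun m ↦ elementaryAction m r b c d f with hL
  have h1 : ∀ m, L m - L (m ^^^ r) = quadSign b c d f * pairSign m r := fun m ↦
    elementaryAction_sub m b c d f
  -- Reindexing by `m ↦ m ^^^ r` transposes the entry of `C`, and skewness supplies the sign.
  -- Averaging the two expressions explains the factor `1 / 2` in `transversePart`.
  have h2 : ∑ m, C (e (m ^^^ r)) m * (L m : ℝ) = ∑ m, -(C (e (m ^^^ r)) m * (L (m ^^^ r) : ℝ)) := by
    rw [← hs]
    refine Finset.sum_congr rfl fun m _ ↦ ?_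
    rw [xor_cancel_right, hC]
    ring
  have h3 : ∑ m, C (e (m ^^^ r)) m * (L m : ℝ) =
      (1 / 2) * ∑ m, C (e (m ^^^ r)) m * ((L m : ℝ) - L (m ^^^ r)) := by
    have : ∑ m, C (e (m ^^^ r)) m * ((L m : ℝ) - L (m ^^^ r)) =
        ∑ m, C (e (m ^^^ r)) m * (L m : ℝ) + ∑ m, -(C (e (m ^^^ r)) m * (L (m ^^^ r) : ℝ)) := by
      rw [← Finset.sum_add_distrib]
      exact Finset.sum_congr rfl fun m _ ↦ by ring
    rw [this, ← h2]
    ring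
  have h4 : ∀ m, (L m : ℝ) - L (m ^^^ r) = quadSign b c d f * pairSign m r := fun m ↦
    mod_cast h1 m
  rw [transversePart]
  simp only [h4] at h3
  refine Eq.trans (Finset.sum_congr rfl fun m _ ↦ ?_) (h3.trans ?_)
  · simp only [hL, elementaryAction]
    push_cast
    ring
  · rw [Finset.mul_sum, Finset.mul_sum, Finset.mul_sum]
    exact Finset.sum_congr rfl fun m _ ↦ by ring

end Action

/-! ### The codifferential of the fundamental form -/

section Codifferential

variable {V : Type*} [NormedAddCommGroup V] [InnerProductSpace ℝ V] [FiniteDimensional ℝ V]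

/-- The vector `a` passes four others, so no sign appears. -/
theorem insertLast_vecCons (η : V [⋀^Fin 8]→ₗ[ℝ] ℝ) (a : V) (u : Fin 4 → V) (w : Fin 3 → V) :
    insertLast (rfl : 5 + 3 = 8) η w (Matrix.vecCons a u) =
      insertLast (rfl : 4 + 4 = 8) η (Matrix.vecCons a w) u := by
  have h := η.map_insertNth 4 a (Fin.append u w)
  have h1 : Fin.append (Matrix.vecCons a u) w ∘ Fin.cast (rfl : 8 = 5 + 3) =
      Matrix.vecCons a (Fin.append u w) := by
    funext i
    fin_cases i <;> rfl
  have h2 : Fin.append u (Matrix.vecCons a w) ∘ Fin.cast (rfl : 8 = 4 + 4) =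
      (4 : Fin 8).insertNth a (Fin.append u w) := by
    funext i
    fin_cases i <;> rfl
  rw [insertLast_apply, insertLast_apply, h1, h2, h]
  norm_num [show ((4 : Fin 8) : ℕ) = 4 from rfl]

/-- Moving a block of three past a block of four is an even permutation. -/
theorem insertLast_append (η : V [⋀^Fin 8]→ₗ[ℝ] ℝ) (u : Fin 3 → V) (v : Fin 4 → V) (x : V) :
    insertLast (rfl : 7 + 1 = 8) η ![x] (Fin.append u v) =
      insertLast (rfl : 4 + 4 = 8) η ![u 0, u 1, u 2, x] v := by
  let σ : Equiv.Perm (Fin 8) := ⟨![3, 4, 5, 6, 0, 1, 2, 7], ![4, 5, 6, 0, 1, 2, 3, 7],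
    by decide, by decide⟩
  have hσ : Equiv.Perm.sign σ = 1 := by decide +kernel
  have h := η.map_perm (Fin.append (Fin.append u v) ![x]) σ
  rw [hσ, one_smul] at h
  rw [insertLast_apply, insertLast_apply]
  refine h.symm.trans (congrArg η (funext fun i ↦ ?_))
  fin_cases i <;> rfl

theorem hodgeStar_alternatize [Fact (finrank ℝ V = 8)] (o : Orientation ℝ V (Fin 8))
    (e : OrthonormalBasis (Fin 8) ℝ V) (H : V → V [⋀^Fin 4]→L[ℝ] ℝ) (α : V [⋀^Fin 5]→L[ℝ] ℝ)
    (hα : ∀ v, α v = ∑ i : Fin 5, (-1) ^ (i : ℕ) * H (v i) (i.removeNth v)) (w : Fin 3 → V) :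
    hodgeStar o (rfl : 5 + 3 = 8) α w =
      ∑ a, hodgeStar o (rfl : 4 + 4 = 8) (H (e a)) (Matrix.vecCons (e a) w) := by
  rw [hodgeStar_apply o _ α e]
  simp only [hodgeStar_apply o _ _ e, ← insertLast_vecCons]
  set κ := insertLast (rfl : 5 + 3 = 8) o.volumeForm w
  -- The sign `(-1) ^ i` cancels against moving slot `i` to the front of `κ`, so all five summands
  -- agree, and `5 / 5! = 1 / 4!` is the constant of the star on 4-forms. In effect `⋆(e^a ∧ β) =
  -- ι_{e_a} ⋆β`.
  have hi : ∀ i : Fin 5, ∑ f : Fin 5 → Fin 8, (-1) ^ (i : ℕ) *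
      H (e (f i)) (i.removeNth fun j ↦ e (f j)) * κ (fun j ↦ e (f j)) =
      ∑ a, ∑ g : Fin 4 → Fin 8, H (e a) (fun j ↦ e (g j)) *
        κ (Matrix.vecCons (e a) fun j ↦ e (g j)) := by
    intro i
    rw [← Fintype.sum_prod_type' fun a (g : Fin 4 → Fin 8) ↦
      H (e a) (fun j ↦ e (g j)) * κ (Matrix.vecCons (e a) fun j ↦ e (g j))]
    refine Fintype.sum_equiv (Fin.insertNthEquiv (fun _ ↦ Fin 8) i).symm _ _ fun f ↦ ?_
    simp only [Fin.insertNthEquiv_symm_apply]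
    have h := κ.neg_one_pow_smul_map_insertNth i (e (f i)) (fun j ↦ e (i.removeNth f j))
    have hf : (i.insertNth (e (f i)) fun j ↦ e (i.removeNth f j) : Fin 5 → V) =
        fun j ↦ e (f j) := by
      funext j
      refine Fin.succAboveCases i ?_ (fun k ↦ ?_) j <;> simp [Fin.removeNth]
    rw [← h, hf, zsmul_eq_mul]
    push_cast
    change _ * H (e (f i)) (fun j ↦ e (i.removeNth f j)) * _ = _
    ring
  simp only [hα, Finset.sum_mul]
  rw [Finset.sum_comm, Finset.sum_congr rfl fun i _ ↦ hi i, Finset.sum_const, ← Finset.mul_sum]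
  simp [Nat.factorial]
  ring

/-- Summing out the four slots of `Φ` against the volume form gives `4! ⋆Φ = 4! Φ`. What is left is
the contraction of `γ` with `Φ`, with constant `(1 / 7!) · 7! / (3! 4!) · 4! = 1 / 6`. -/
theorem hodgeStar_wedge [Fact (finrank ℝ V = 8)] (o : Orientation ℝ V (Fin 8))
    (e : OrthonormalBasis (Fin 8) ℝ V) (γ : V [⋀^Fin 3]→L[ℝ] ℝ) (Φ : V [⋀^Fin 4]→L[ℝ] ℝ)
    (hΦ : hodgeStar o (rfl : 4 + 4 = 8) Φ = Φ) (x : V) :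
    hodgeStar o (rfl : 3 + 4 + 1 = 8) (wedge γ Φ) ![x] =
      (1 / 6) * ∑ f : Fin 3 → Fin 8, γ (fun i ↦ e (f i)) * Φ ![e (f 0), e (f 1), e (f 2), x] := by
  rw [hodgeStar_apply o _ _ e]
  have h := sum_wedge_mul e γ Φ (insertLast (rfl : 3 + 4 + 1 = 8) o.volumeForm ![x])
  have h2 : ∀ f : Fin 3 → Fin 8, ∑ g : Fin 4 → Fin 8, Φ (fun i ↦ e (g i)) *
      insertLast (rfl : 3 + 4 + 1 = 8) o.volumeForm ![x]
        (Fin.append (fun i ↦ e (f i)) (fun i ↦ e (g i))) =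
      24 * Φ ![e (f 0), e (f 1), e (f 2), x] := by
    intro f
    conv_rhs => rw [← hΦ, hodgeStar_apply o _ _ e]
    rw [← mul_assoc, show (24 * ((Nat.factorial 4 : ℕ) : ℝ)⁻¹) = 1 by norm_num [Nat.factorial],
      one_mul]
    exact Finset.sum_congr rfl fun g _ ↦ congrArg _ (insertLast_append _ _ _ _)
  simp only [mul_assoc, ← Finset.mul_sum, h2] at h
  simp only [mul_left_comm _ (24 : ℝ), ← Finset.mul_sum] at h
  norm_num [Nat.factorial] at h ⊢
  linarith

theorem sum_fin_three {κ : Type*} [Fintype κ] (F : κ → κ → κ → ℝ) :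
    ∑ f : Fin 3 → κ, F (f 0) (f 1) (f 2) = ∑ x, ∑ y, ∑ z, F x y z := by
  simp only [← Fintype.sum_prod_type']
  let equiv : (Fin 3 → κ) ≃ κ × κ × κ :=
    { toFun := fun f ↦ (f 0, f 1, f 2)
      invFun := fun p ↦ ![p.1, p.2.1, p.2.2]
      left_inv := fun f ↦ by funext i; fin_cases i <;> rfl
      right_inv := fun p ↦ rfl }
  exact Equiv.sum_comp equiv fun p ↦ F p.1 p.2.1 p.2.2

theorem sum_comm_four {κ : Type*} [Fintype κ] (F : κ → κ → κ → κ → ℝ) :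
    ∑ x, ∑ y, ∑ z, ∑ i, F x y z i = ∑ i, ∑ x, ∑ y, ∑ z, F x y z i := by
  have h1 : ∀ x y, ∑ z, ∑ i, F x y z i = ∑ i, ∑ z, F x y z i := fun _ _ ↦ Finset.sum_comm
  have h2 : ∀ x, ∑ y, ∑ i, ∑ z, F x y z i = ∑ i, ∑ y, ∑ z, F x y z i := fun _ ↦ Finset.sum_comm
  simp only [h1, h2]
  exact Finset.sum_comm

/-! ### Recovering the transverse parts from `δΦ` -/

theorem sum_formCoeff_mul (a b c : Fin 8) (φ : Fin 8 → ℝ) :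
    ∑ n, formCoeff a b c n * φ n = formCoeff a b c (a ^^^ b ^^^ c) * φ (a ^^^ b ^^^ c) := by
  refine Finset.sum_eq_single _ (fun n _ hn ↦ ?_) (by simp)
  have : a ^^^ b ^^^ c ^^^ n ≠ 0 := by
    intro h
    apply hn
    rw [← xor_cancel_left (a ^^^ b ^^^ c) n, h, xor_zero]
  simp [formCoeff, this]

/-- The components of `⋆(δΦ ∧ Φ)` in terms of the transverse parts of the connection form. -/
theorem sum_codiff_mul_formCoeff (t : Fin 8 → Fin 8 → ℝ) (ht : ∀ i, t i 0 = 0) (n : Fin 8) :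
    (1 / 6) * ∑ x, ∑ y, ∑ z, (-∑ i, quadSign i x y z * t i (i ^^^ x ^^^ y ^^^ z)) *
      formCoeff x y z n = -4 * ∑ i, pairSign i (i ^^^ n) * t i (i ^^^ n) := by
  have h1 : ∀ x y z i : Fin 8, (quadSign i x y z * t i (i ^^^ x ^^^ y ^^^ z)) * formCoeff x y z n =
      (quadSign i x y z * formCoeff x y z n : ℤ) * t i (i ^^^ n) := by
    intro x y z i
    by_cases h : x ^^^ y ^^^ z ^^^ n = 0
    · have hn : i ^^^ x ^^^ y ^^^ z = i ^^^ n := by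
        rw [← xor_cancel_right (i ^^^ x ^^^ y ^^^ z) n]
        have h' := congrArg (i ^^^ · ^^^ n) h
        simp only [xor_assoc, xor_zero] at h h' ⊢
        rw [h']
      rw [hn]
      push_cast
      ring
    · simp [formCoeff, h]
  have h2 : ∀ i, ∑ x, ∑ y, ∑ z, ((quadSign i x y z * formCoeff x y z n : ℤ) : ℝ) * t i (i ^^^ n) =
      24 * (pairSign i (i ^^^ n) * t i (i ^^^ n)) := by
    intro i
    simp only [← Finset.sum_mul]
    rcases eq_or_ne i n with rfl | hin
    · simp [ht]
    · have := sum_quadSign_mul_formCoeff i n hin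
      have h : (∑ x, ∑ y, ∑ z, ((quadSign i x y z * formCoeff x y z n : ℤ) : ℝ)) =
          24 * pairSign i (i ^^^ n) := by exact_mod_cast this
      rw [h]
      ring
  simp only [neg_mul, Finset.sum_mul, h1, Finset.sum_neg_distrib]
  rw [sum_comm_four, Finset.sum_congr rfl fun i _ ↦ h2 i, ← Finset.mul_sum]
  ring

/-- The transverse parts of the connection form are recovered from the components of the
codifferential of the fundamental form. -/
theorem transverse_eq (t : Fin 8 → Fin 8 → ℝ) (ht : ∀ i, t i 0 = 0) (δ : Fin 8 → Fin 8 → Fin 8 → ℝ)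
    (hδ : ∀ x y z, δ x y z = -∑ i, quadSign i x y z * t i (i ^^^ x ^^^ y ^^^ z)) (η : Fin 8 → ℝ)
    (hη : ∀ n, η n = (1 / 6) * ∑ x, ∑ y, ∑ z, δ x y z * formCoeff x y z n) (a s : Fin 8) :
    (1 / 2) * ∑ m, pairSign m s * (-((1 / 2) * δ a (m ^^^ s) m
      - (1 / 12) * ∑ n, formCoeff a (m ^^^ s) m n * η n)) = t a s := by
  have hη' : ∀ n, η n = -4 * ∑ i, pairSign i (i ^^^ n) * t i (i ^^^ n) := by
    intro n
    rw [hη, ← sum_codiff_mul_formCoeff t ht]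
    simp only [hδ]
  have hx : ∀ m, a ^^^ (m ^^^ s) ^^^ m = a ^^^ s := by
    intro m
    rw [xor_assoc, LawfulXor.xor_comm m s, xor_cancel_right]
  have hx' : ∀ m i, i ^^^ a ^^^ (m ^^^ s) ^^^ m = i ^^^ (a ^^^ s) := by
    intro m i
    rw [← hx m]
    simp only [xor_assoc]
  -- This is the coefficient of `t i` after `δ` and `η` are substituted, with `-1 / 12` factored
  -- out: the weights `1 / 4` and `-1 / 6` become `-3` and `2`.
  have key : ∀ i, t i (i ^^^ (a ^^^ s)) * ∑ m, ((pairSign m s * (-3 * quadSign i a (m ^^^ s) m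
      + 2 * formCoeff a (m ^^^ s) m (a ^^^ s) * pairSign i (i ^^^ (a ^^^ s))) : ℤ) : ℝ) =
      if i = a then -12 * t a s else 0 := by
    intro i
    -- The case missing from `sum_pairSign_mul` contributes nothing, because its transverse part has
    -- label `0`; if moreover `i = a`, then `s = 0` and the right side vanishes too.
    rcases eq_or_ne i (a ^^^ s) with h | h
    · rw [h, LawfulXor.xor_self, ht, zero_mul]
      split_ifs with h'
      · have hs : s = 0 := by
          rw [← xor_cancel_left a s, h', LawfulXor.xor_self]
        rw [hs, ht, mul_zero]
      · rfl
    · have := sum_pairSign_mul a s i h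
      rw [← Int.cast_sum, this]
      split_ifs with h'
      · rw [h', xor_cancel_left]
        push_cast
        ring
      · simp
  have hsum : ∑ i, (if i = a then -12 * t a s else 0) = -12 * t a s := by simp
  simp only [hδ, sum_formCoeff_mul, hx, hx', hη']
  calc _ = ∑ m, ∑ i, (-1 / 12) * (t i (i ^^^ (a ^^^ s)) *
        ((pairSign m s * (-3 * quadSign i a (m ^^^ s) m + 2 * formCoeff a (m ^^^ s) m (a ^^^ s) *
          pairSign i (i ^^^ (a ^^^ s))) : ℤ) : ℝ)) := by
        rw [Finset.mul_sum]
        refine Finset.sum_congr rfl fun m _ ↦ ?_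
        rw [show ∀ S₁ S₂ J φ : ℝ, 1 / 2 * (J * -(1 / 2 * -S₁ - 1 / 12 * (φ * (-4 * S₂)))) =
          (1 / 4) * J * S₁ - (1 / 6) * J * φ * S₂ by intros; ring, Finset.mul_sum, Finset.mul_sum,
          ← Finset.sum_sub_distrib]
        refine Finset.sum_congr rfl fun i _ ↦ ?_
        push_cast
        ring
    _ = (-1 / 12) * ∑ i, (if i = a then -12 * t a s else 0) := by
        rw [Finset.sum_comm, Finset.mul_sum]
        refine Finset.sum_congr rfl fun i _ ↦ ?_
        rw [← key i, Finset.mul_sum, Finset.mul_sum]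
    _ = t a s := by rw [hsum]; ring

end Codifferential

/-! ### The pointwise identity -/

section Pointwise

variable {V : Type*} [NormedAddCommGroup V] [InnerProductSpace ℝ V] [FiniteDimensional ℝ V]

theorem apply_eq_sum_update {k : ℕ} {κ : Type*} [Fintype κ] (e : OrthonormalBasis κ ℝ V)
    (α : V [⋀^Fin k]→L[ℝ] ℝ) (v : Fin k → V) (s : Fin k) :
    α v = ∑ m, ⟪e m, v s⟫ * α (Function.update v s (e m)) := by
  have h : v = Function.update v s (∑ m, ⟪e m, v s⟫ • e m) := by
    rw [e.sum_repr', Function.update_eq_self]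
  conv_lhs => rw [h]
  exact (α.toAlternatingMap.map_update_sum _ _ _ _).trans
    (Finset.sum_congr rfl fun m _ ↦ α.toAlternatingMap.map_update_smul _ _ _ _)

theorem apply_vecThree_fst (e : OrthonormalBasis (Fin 8) ℝ V) (δ : V [⋀^Fin 3]→L[ℝ] ℝ)
    (x y z : V) : δ ![x, y, z] = ∑ m, ⟪e m, x⟫ * δ ![e m, y, z] := by
  rw [apply_eq_sum_update e δ _ 0]
  refine Finset.sum_congr rfl fun m _ ↦ congrArg₂ _ rfl (congrArg δ (funext fun i ↦ ?_))
  fin_cases i <;> rfl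

theorem apply_vecThree_trd (e : OrthonormalBasis (Fin 8) ℝ V) (δ : V [⋀^Fin 3]→L[ℝ] ℝ)
    (x y z : V) : δ ![x, y, z] = ∑ m, ⟪e m, z⟫ * δ ![x, y, e m] := by
  rw [apply_eq_sum_update e δ _ 2]
  refine Finset.sum_congr rfl fun m _ ↦ congrArg₂ _ rfl (congrArg δ (funext fun i ↦ ?_))
  fin_cases i <;> rfl

theorem apply_vecFour_fst (e : OrthonormalBasis (Fin 8) ℝ V) (Φ : V [⋀^Fin 4]→L[ℝ] ℝ)
    (x y z t : V) : Φ ![x, y, z, t] = ∑ m, ⟪e m, x⟫ * Φ ![e m, y, z, t] := by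
  rw [apply_eq_sum_update e Φ _ 0]
  refine Finset.sum_congr rfl fun m _ ↦ congrArg₂ _ rfl (congrArg Φ (funext fun i ↦ ?_))
  fin_cases i <;> rfl

theorem apply_vecFour_trd (e : OrthonormalBasis (Fin 8) ℝ V) (Φ : V [⋀^Fin 4]→L[ℝ] ℝ)
    (x y z t : V) : Φ ![x, y, z, t] = ∑ m, ⟪e m, z⟫ * Φ ![x, y, e m, t] := by
  rw [apply_eq_sum_update e Φ _ 2]
  refine Finset.sum_congr rfl fun m _ ↦ congrArg₂ _ rfl (congrArg Φ (funext fun i ↦ ?_))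
  fin_cases i <;> rfl

theorem vecThree_swap (δ : V [⋀^Fin 3]→L[ℝ] ℝ) (x y z : V) : δ ![x, z, y] = -δ ![x, y, z] := by
  refine Eq.trans (congrArg δ (funext fun i ↦ ?_))
    (δ.toAlternatingMap.map_swap ![x, y, z] (i := 1) (j := 2) (by decide))
  fin_cases i <;> rfl

theorem vecFour_swap_snd (Φ : V [⋀^Fin 4]→L[ℝ] ℝ) (x y z t : V) :
    Φ ![x, z, y, t] = -Φ ![x, y, z, t] := by
  refine Eq.trans (congrArg Φ (funext fun i ↦ ?_))
    (Φ.toAlternatingMap.map_swap ![x, y, z, t] (i := 1) (j := 2) (by decide))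
  fin_cases i <;> rfl

theorem vecFour_swap_fst (Φ : V [⋀^Fin 4]→L[ℝ] ℝ) (x y z t : V) :
    Φ ![y, x, z, t] = -Φ ![x, y, z, t] := by
  refine Eq.trans (congrArg Φ (funext fun i ↦ ?_))
    (Φ.toAlternatingMap.map_swap ![x, y, z, t] (i := 0) (j := 1) (by decide))
  fin_cases i <;> rfl

theorem vecFour_swap_trd (Φ : V [⋀^Fin 4]→L[ℝ] ℝ) (x y z t : V) :
    Φ ![x, y, t, z] = -Φ ![x, y, z, t] := by
  refine Eq.trans (congrArg Φ (funext fun i ↦ ?_))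
    (Φ.toAlternatingMap.map_swap ![x, y, z, t] (i := 2) (j := 3) (by decide))
  fin_cases i <;> rfl

/-- Two skew variations that differ by an element of `spin(7)` move the standard form in the same
way. This is what permits the connection form to be replaced by one built from `δΦ`. -/
theorem coframeVariation_congr (e : OrthonormalBasis (Fin 8) ℝ V) {C C' : V →L[ℝ] (Fin 8 → ℝ)}
    (hC : ∀ m b, C (e b) m = -C (e m) b) (hC' : ∀ m b, C' (e b) m = -C' (e m) b)
    (h : ∀ r, transversePart e C r = transversePart e C' r) :
    coframeVariation e C = coframeVariation e C' := by
  refine ContinuousAlternatingMap.toAlternatingMap_injective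
    (e.toBasis.ext_alternating fun w _ ↦ ?_)
  simp only [OrthonormalBasis.coe_toBasis, ContinuousAlternatingMap.coe_toAlternatingMap]
  rw [coframeVariation_basis e C hC, coframeVariation_basis e C' hC', h]

theorem transversePart_zero (e : OrthonormalBasis (Fin 8) ℝ V) (C : V →L[ℝ] (Fin 8 → ℝ)) :
    transversePart e C 0 = 0 := by
  simp [transversePart, pairSign]

theorem transversePart_apply_eq_sum (e : OrthonormalBasis (Fin 8) ℝ V)
    (N : V →L[ℝ] V →L[ℝ] (Fin 8 → ℝ)) (x : V) (r : Fin 8) :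
    transversePart e (N x) r = ∑ a, ⟪e a, x⟫ * transversePart e (N (e a)) r := by
  have h : ∀ m, N x (e (m ^^^ r)) m = ∑ a, ⟪e a, x⟫ * N (e a) (e (m ^^^ r)) m := by
    intro m
    conv_lhs => rw [← e.sum_repr' x]
    simp
  simp only [transversePart, h, Finset.mul_sum]
  rw [Finset.sum_comm]
  exact Finset.sum_congr rfl fun a _ ↦ Finset.sum_congr rfl fun m _ ↦ by ring

/-- If a 4-form is the standard `Spin(7)` form in the orthonormal frame `e`, then its variation along
a skew-symmetric coframe variation is determined by the associated codifferential. -/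
theorem coframeVariation_eq_codifferential (e : OrthonormalBasis (Fin 8) ℝ V)
    (N : V →L[ℝ] V →L[ℝ] (Fin 8 → ℝ)) (hN : ∀ x m b, N x (e b) m = -N x (e m) b)
    (Φ : V [⋀^Fin 4]→L[ℝ] ℝ)
    (hΦ : Φ = continuousStandardForm.compContinuousLinearMap (coframe e))
    (δ : V [⋀^Fin 3]→L[ℝ] ℝ)
    (hδ : ∀ x y z, δ ![e x, e y, e z] =
      -∑ i, quadSign i x y z * transversePart e (N (e i)) (i ^^^ x ^^^ y ^^^ z))
    (η : V → ℝ) (hη : ∀ v, η v =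
      (1 / 6) * ∑ f : Fin 3 → Fin 8, δ (fun i ↦ e (f i)) * Φ ![e (f 0), e (f 1), e (f 2), v])
    (X Y Z T W : V) :
    coframeVariation e (N X) ![Y, Z, T, W] =
      (1 / 2) * (δ ![X, Y, crossProduct Φ Z T W] - δ ![X, Z, crossProduct Φ Y T W])
      + (1 / 2) * (δ ![X, T, crossProduct Φ Y Z W] - δ ![X, W, crossProduct Φ Y Z T])
      - (1 / 12) * (η (crossProduct Φ X Y (crossProduct Φ Z T W))
        - η (crossProduct Φ X Z (crossProduct Φ Y T W)))
      - (1 / 12) * (η (crossProduct Φ X T (crossProduct Φ Y Z W))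
        - η (crossProduct Φ X W (crossProduct Φ Y Z T))) := by
  have hΦe : ∀ a b c d, Φ ![e a, e b, e c, e d] = formCoeff a b c d := by
    intro a b c d
    rw [hΦ]
    refine Eq.trans (congrArg standardForm (funext fun i ↦ ?_)) (standardForm_single ![a, b, c, d])
    rw [← coframe_basis e]
    fin_cases i <;> rfl
  have hηlin : ∀ v, η v = ∑ n, ⟪e n, v⟫ * η (e n) := by
    intro v
    have h4 : ∀ a b c, Φ ![e a, e b, e c, v] = ∑ n, ⟪e n, v⟫ * Φ ![e a, e b, e c, e n] := by
      intro a b c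
      rw [apply_eq_sum_update e Φ _ 3]
      refine Finset.sum_congr rfl fun m _ ↦ congrArg₂ _ rfl (congrArg Φ (funext fun i ↦ ?_))
      fin_cases i <;> rfl
    simp only [hη, h4, Finset.mul_sum]
    rw [Finset.sum_comm]
    exact Finset.sum_congr rfl fun n _ ↦ Finset.sum_congr rfl fun f _ ↦ by ring
  have hηe : ∀ n, η (e n) =
      (1 / 6) * ∑ x, ∑ y, ∑ z, δ ![e x, e y, e z] * formCoeff x y z n := by
    intro n
    rw [hη, ← sum_fin_three fun x y z ↦ δ ![e x, e y, e z] * formCoeff x y z n]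
    refine congrArg _ (Finset.sum_congr rfl fun f _ ↦ ?_)
    rw [hΦe]
    refine congrArg₂ _ (congrArg δ (funext fun i ↦ ?_)) rfl
    fin_cases i <;> rfl
  -- `C u` represents `v ↦ -(½ δ(X, u, v) - ¹⁄₁₂ η(P(X, u, v)))`. The minus sign compensates for
  -- moving the first slot of `Φ` past three others when the action of `C` is rewritten through the
  -- cross product.
  let C : V →L[ℝ] (Fin 8 → ℝ) := ContinuousLinearMap.pi fun m ↦
    -((1 / 2 : ℝ) • δ.toContinuousLinearMap ![X, 0, e m] 1
      - (1 / 12 : ℝ) • ∑ n, η (e n) • Φ.toContinuousLinearMap ![X, 0, e m, e n] 1)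
  have hC : ∀ u m, C u m = -((1 / 2) * δ ![X, u, e m]
      - (1 / 12) * ∑ n, Φ ![X, u, e m, e n] * η (e n)) := by
    intro u m
    have h3 : Function.update ![X, 0, e m] 1 u = ![X, u, e m] := by
      funext i; fin_cases i <;> rfl
    have h4 : ∀ n, Function.update ![X, 0, e m, e n] 1 u = ![X, u, e m, e n] := by
      intro n; funext i; fin_cases i <;> rfl
    simp only [C, ContinuousLinearMap.pi_apply, neg_apply,
      sub_apply, smul_apply, sum_apply,
      ContinuousAlternatingMap.toContinuousLinearMap_apply, h3, h4, smul_eq_mul, mul_comm (η _)]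
  have hCskew : ∀ m b, C (e b) m = -C (e m) b := by
    intro m b
    rw [hC, hC, vecThree_swap δ X (e b) (e m)]
    simp only [vecFour_swap_snd Φ X (e b) (e m), neg_mul, Finset.sum_neg_distrib]
    ring
  -- The inversion formula holds for each basis direction `e a`; linearity in `X` gives the general
  -- case.
  have htr : ∀ r, transversePart e (N X) r = transversePart e C r := by
    intro r
    rw [transversePart_apply_eq_sum, transversePart]
    have hCX : ∀ m, C (e (m ^^^ r)) m = ∑ a, ⟪e a, X⟫ * -((1 / 2) * δ ![e a, e (m ^^^ r), e m]
        - (1 / 12) * ∑ n, formCoeff a (m ^^^ r) m n * η (e n)) := by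
      intro m
      rw [hC, apply_vecThree_fst e]
      simp only [apply_vecFour_fst e Φ X, hΦe, Finset.sum_mul, Finset.mul_sum]
      rw [Finset.sum_comm, ← Finset.sum_sub_distrib, ← Finset.sum_neg_distrib]
      refine Finset.sum_congr rfl fun a _ ↦ ?_
      rw [mul_neg, mul_sub, Finset.mul_sum]
      refine congrArg _ (congrArg₂ _ (by ring) (Finset.sum_congr rfl fun n _ ↦ by ring))
    have ht := fun a ↦ transverse_eq (fun i r ↦ transversePart e (N (e i)) r)
      (fun i ↦ transversePart_zero e _) (fun x y z ↦ δ ![e x, e y, e z]) hδ (fun n ↦ η (e n)) hηe a r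
    simp only [hCX, ← ht, Finset.mul_sum]
    rw [Finset.sum_comm]
    exact Finset.sum_congr rfl fun m _ ↦ Finset.sum_congr rfl fun a _ ↦ by ring
  -- The vector dual to `C u`, paired with a cross product `p`, yields exactly one `δ` term and one
  -- `η` term of the conclusion.
  have hsharp : ∀ u p, ⟪p, ∑ m, C u m • e m⟫ =
      -((1 / 2) * δ ![X, u, p] - (1 / 12) * η (crossProduct Φ X u p)) := by
    intro u p
    have h1 : η (crossProduct Φ X u p) = ∑ m, ⟪e m, p⟫ * ∑ n, Φ ![X, u, e m, e n] * η (e n) := by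
      rw [hηlin]
      simp only [real_inner_comm, inner_crossProduct]
      simp only [apply_vecFour_trd e Φ X u p, Finset.sum_mul, Finset.mul_sum]
      rw [Finset.sum_comm]
      refine Finset.sum_congr rfl fun m _ ↦ Finset.sum_congr rfl fun n _ ↦ ?_
      rw [real_inner_comm p]
      ring
    rw [h1, apply_vecThree_trd e δ X u p, inner_sum, Finset.mul_sum, Finset.mul_sum,
      ← Finset.sum_sub_distrib, ← Finset.sum_neg_distrib]
    refine Finset.sum_congr rfl fun m _ ↦ ?_
    rw [inner_smul_right, hC, real_inner_comm]
    ring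
  have hupd : ∀ (v : Fin 4 → V) (s : Fin 4),
      standardForm (Function.update (fun j ↦ coframe e (v j)) s (C (v s))) =
        Φ (Function.update v s (∑ m, C (v s) m • e m)) := by
    intro v s
    rw [hΦ]
    refine congrArg standardForm (funext fun j ↦ ?_)
    rcases eq_or_ne j s with rfl | h
    · ext i
      simp [e.inner_eq_ite]
    · simp [h]
  rw [coframeVariation_congr e (hN X) hCskew htr, coframeVariation_apply, Fin.sum_univ_four]
  simp only [hupd]
  have hv : ∀ a b c d : V, (∀ q, Function.update ![a, b, c, d] 0 q = ![q, b, c, d]) ∧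
      (∀ q, Function.update ![a, b, c, d] 1 q = ![a, q, c, d]) ∧
      (∀ q, Function.update ![a, b, c, d] 2 q = ![a, b, q, d]) ∧
      ∀ q, Function.update ![a, b, c, d] 3 q = ![a, b, c, q] := by
    intro a b c d
    refine ⟨fun q ↦ ?_, fun q ↦ ?_, fun q ↦ ?_, fun q ↦ ?_⟩ <;> funext i <;> fin_cases i <;> rfl
  obtain ⟨h0, h1, h2, h3⟩ := hv Y Z T W
  rw [h0, h1, h2, h3, vecFour_swap_fst Φ Z _ T W, vecFour_swap_snd Φ Z T _ W,
    vecFour_swap_trd Φ Z T W, vecFour_swap_snd Φ Y T _ W, vecFour_swap_trd Φ Y T W,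
    vecFour_swap_trd Φ Y Z W]
  simp only [← inner_crossProduct, hsharp]
  simp only [Matrix.cons_val]
  ring

end Pointwise

/-! ### The connection form of an orthonormal frame -/

section ConnectionForm

variable {V : Type*} [NormedAddCommGroup V] [InnerProductSpace ℝ V] [FiniteDimensional ℝ V]

/-- The vector-valued bilinear form `(x, u) ↦ (⟪L i x, u⟫)ᵢ`. -/
def connectionForm (L : Fin 8 → V →L[ℝ] V) : V →L[ℝ] V →L[ℝ] (Fin 8 → ℝ) :=
  LinearMap.toContinuousLinearMap
    { toFun := fun x ↦ ContinuousLinearMap.pi fun i ↦ innerSL ℝ (L i x)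
      map_add' := fun x y ↦ by ext; simp
      map_smul' := fun c x ↦ by ext; simp }

/-- The variation of the standard form along the value of a connection form. -/
@[irreducible] def connectionVariation (e : OrthonormalBasis (Fin 8) ℝ V) (N : V →L[ℝ] V →L[ℝ] (Fin 8 → ℝ))
    (x : V) : V [⋀^Fin 4]→L[ℝ] ℝ :=
  coframeVariation e (N x)

/-- The exterior derivative of the pullback of the standard form along a coframe in a chart only
depends on the part of the derivative of the coframe that is not symmetric. -/
theorem alternatizeUncurryFin_fderivComp_coframe {E : Type*} [NormedAddCommGroup E]
    [NormedSpace ℝ E] (e : OrthonormalBasis (Fin 8) ℝ V) (A : E →L[ℝ] V) (B : V →L[ℝ] E)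
    (hAB : ∀ v, A (B v) = v) (T : E →L[ℝ] E →L[ℝ] (Fin 8 → ℝ)) (N : V →L[ℝ] V →L[ℝ] (Fin 8 → ℝ))
    (hT : ∀ u v, T u v - N (A u) (A v) = T v u - N (A v) (A u)) (v : Fin 5 → V) :
    ContinuousAlternatingMap.alternatizeUncurryFin
      (continuousStandardForm.fderivCompContinuousLinearMap (coframe e ∘L A) ∘L T)
      (fun i ↦ B (v i)) =
    ∑ i : Fin 5, (-1) ^ (i : ℕ) * connectionVariation e N (v i) (i.removeNth v) := by
  set K : E →L[ℝ] E →L[ℝ] (Fin 8 → ℝ) := N.bilinearComp A A with hK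
  have h1 : ContinuousAlternatingMap.alternatizeUncurryFin
      (continuousStandardForm.fderivCompContinuousLinearMap (coframe e ∘L A) ∘L T) =
      ContinuousAlternatingMap.alternatizeUncurryFin
        (continuousStandardForm.fderivCompContinuousLinearMap (coframe e ∘L A) ∘L K) := by
    -- The difference `T - K` is symmetric by `hT`, and alternation kills its contribution, just as
    -- `d² = 0` comes from symmetric second derivatives.
    have h2 := ContinuousAlternatingMap.alternatizeUncurryFin_fderivCompContinuousLinearMap_eq_zero
      continuousStandardForm (coframe e ∘L A) (h := T - K) hT
    have h3 : T = (T - K) + K := (sub_add_cancel T K).symm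
    rw [h3, ContinuousLinearMap.comp_add, ContinuousAlternatingMap.alternatizeUncurryFin_add, h2,
      zero_add]
  rw [h1, ContinuousAlternatingMap.alternatizeUncurryFin_apply]
  refine Finset.sum_congr rfl fun i _ ↦ ?_
  rw [zsmul_eq_mul]
  push_cast
  refine congrArg _ ?_
  rw [connectionVariation, coframeVariation_apply]
  refine (ContinuousAlternatingMap.fderivCompContinuousLinearMap_apply _ _ _ _).trans ?_
  refine Finset.sum_congr rfl fun s _ ↦ ?_
  rw [continuousStandardForm_apply]
  refine congrArg _ (funext fun j ↦ ?_)
  rcases eq_or_ne j s with rfl | h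
  · simp [hK, hAB, Fin.removeNth]
  · simp [h, hAB, Fin.removeNth]

end ConnectionForm

/-! ### Coordinate vector fields -/

section CoordinateField

variable {n : ℕ} {M : Type*} [TopologicalSpace M] [ChartedSpace (EuclideanSpace ℝ (Fin n)) M]
  [IsManifold (𝓡 n) ∞ M]

theorem two_le_infty : (2 : ℕ∞ω) ≤ ∞ := WithTop.coe_le_coe.2 (le_top : (2 : ℕ∞) ≤ ⊤)

/-- A constant vector field on a Euclidean space. -/
def constantField (u : EuclideanSpace ℝ (Fin n)) :
    Π y : EuclideanSpace ℝ (Fin n), TangentSpace 𝓘(ℝ, EuclideanSpace ℝ (Fin n)) y :=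
  fun _ ↦ u

theorem mdifferentiableAt_constantField (u y : EuclideanSpace ℝ (Fin n)) :
    MDifferentiableAt 𝓘(ℝ, EuclideanSpace ℝ (Fin n)) (𝓘(ℝ, EuclideanSpace ℝ (Fin n))).tangent
      (fun z ↦ (⟨z, constantField u z⟩ : TangentBundle 𝓘(ℝ, EuclideanSpace ℝ (Fin n))
        (EuclideanSpace ℝ (Fin n)))) y :=
  (contMDiffAt_vectorSpace_iff_contDiffAt (n := 1).2 contDiffAt_const).mdifferentiableAt one_ne_zero

theorem mlieBracket_constantField (u v y : EuclideanSpace ℝ (Fin n)) :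
    VectorField.mlieBracket 𝓘(ℝ, EuclideanSpace ℝ (Fin n)) (constantField u) (constantField v) y =
      0 := by
  rw [← VectorField.mlieBracketWithin_univ, VectorField.mlieBracketWithin_eq_lieBracketWithin]
  have h (w : EuclideanSpace ℝ (Fin n)) :
      fderiv ℝ (fun _ : EuclideanSpace ℝ (Fin n) ↦ w) y = 0 := fderiv_const_apply w
  change VectorField.lieBracketWithin ℝ (fun _ : EuclideanSpace ℝ (Fin n) ↦ u) (fun _ ↦ v)
    Set.univ y = 0
  rw [VectorField.lieBracketWithin_univ, VectorField.lieBracket_eq]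
  beta_reduce
  rw [h, h]
  simp

/-- The vector field that is constant, equal to `u`, in the chart at `p`. -/
def coordinateField (p : M) (u : EuclideanSpace ℝ (Fin n)) : Π q : M, TangentSpace (𝓡 n) q :=
  VectorField.mpullback (𝓡 n) 𝓘(ℝ, EuclideanSpace ℝ (Fin n)) (extChartAt (𝓡 n) p) (constantField u)

theorem mdifferentiableAt_coordinateField (p : M) (u : EuclideanSpace ℝ (Fin n)) :
    MDifferentiableAt (𝓡 n) (𝓡 n).tangent
      (fun q ↦ (⟨q, coordinateField p u q⟩ : TangentBundle (𝓡 n) M)) p :=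
  MDifferentiableAt.mpullback_vectorField (n := ∞) (mdifferentiableAt_constantField u _)
    contMDiffAt_extChartAt (isInvertible_mfderiv_extChartAt (mem_extChartAt_source p))
    two_le_infty

/-- Brackets commute with pullback, and constant fields commute. -/
theorem mlieBracket_coordinateField (p : M) (u v : EuclideanSpace ℝ (Fin n)) :
    VectorField.mlieBracket (𝓡 n) (coordinateField p u) (coordinateField p v) p = 0 := by
  have : IsManifold (𝓡 n) (minSmoothness ℝ 2) M := by
    rw [minSmoothness_of_isRCLikeNormedField]
    infer_instance
  have h := VectorField.mpullback_mlieBracket (n := ∞) (x₀ := p)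
    (mdifferentiableAt_constantField u (extChartAt (𝓡 n) p p))
    (mdifferentiableAt_constantField v (extChartAt (𝓡 n) p p)) contMDiffAt_extChartAt (by
      rw [minSmoothness_of_isRCLikeNormedField]
      exact two_le_infty)
  refine h.symm.trans ?_
  rw [VectorField.mpullback_apply, mlieBracket_constantField]
  exact map_zero _

theorem coordinateField_extChartAt_symm (p : M) (u : EuclideanSpace ℝ (Fin n))
    {y : EuclideanSpace ℝ (Fin n)} (hy : y ∈ (extChartAt (𝓡 n) p).target) :
    coordinateField p u ((extChartAt (𝓡 n) p).symm y) =
      mfderiv 𝓘(ℝ, EuclideanSpace ℝ (Fin n)) (𝓡 n) (extChartAt (𝓡 n) p).symm y u := by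
  have h1 := mfderivWithin_extChartAt_symm_comp_mfderiv_extChartAt hy
  have h2 := mfderiv_extChartAt_comp_mfderivWithin_extChartAt_symm hy
  rw [(𝓡 n).range_eq_univ, mfderivWithin_univ] at h1 h2
  rw [coordinateField, VectorField.mpullback_apply]
  exact DFunLike.congr_fun (ContinuousLinearMap.inverse_eq h2 h1) u

end CoordinateField

/-! ### Derivatives in a chart -/

section Chart

/-- A family of continuous linear maps on a finite-dimensional space is differentiable if all its
values are. -/
theorem differentiableAt_of_clm_apply {D E F : Type*} [NormedAddCommGroup D] [NormedSpace ℝ D]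
    [NormedAddCommGroup E] [NormedSpace ℝ E] [NormedAddCommGroup F] [NormedSpace ℝ F]
    [FiniteDimensional ℝ E] {f : D → E →L[ℝ] F} {x : D}
    (h : ∀ u, DifferentiableAt ℝ (fun y ↦ f y u) x) : DifferentiableAt ℝ f x := by
  have hd : finrank ℝ E = finrank ℝ (Fin (finrank ℝ E) → ℝ) := (finrank_fin_fun ℝ).symm
  let e₁ := ContinuousLinearEquiv.ofFinrankEq hd
  let e₂ := (e₁.arrowCongr (1 : F ≃L[ℝ] F)).trans
    (ContinuousLinearEquiv.piRing (Fin (finrank ℝ E)))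
  rw [← Function.id_comp f, ← e₂.symm_comp_self]
  exact e₂.symm.differentiableAt.comp x (differentiableAt_pi.2 fun i ↦ h _)

variable {n : ℕ} {M : Type*} [TopologicalSpace M] [ChartedSpace (EuclideanSpace ℝ (Fin n)) M]
  [IsManifold (𝓡 n) ∞ M]

/-- The derivative at `p` of the inverse of the chart at `p`. -/
def chartSymmDeriv (p : M) : EuclideanSpace ℝ (Fin n) →L[ℝ] TangentSpace (𝓡 n) p :=
  mfderiv 𝓘(ℝ, EuclideanSpace ℝ (Fin n)) (𝓡 n) (extChartAt (𝓡 n) p).symm (extChartAt (𝓡 n) p p)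

/-- The derivative at `p` of the chart at `p`. -/
def chartDeriv (p : M) : TangentSpace (𝓡 n) p →L[ℝ] EuclideanSpace ℝ (Fin n) :=
  mfderiv (𝓡 n) 𝓘(ℝ, EuclideanSpace ℝ (Fin n)) (extChartAt (𝓡 n) p) p

theorem chartSymmDeriv_chartDeriv (p : M) (v : TangentSpace (𝓡 n) p) :
    chartSymmDeriv p (chartDeriv p v) = v := by
  have h := mfderivWithin_extChartAt_symm_comp_mfderiv_extChartAt' (I := 𝓡 n)
    (mem_extChartAt_source (I := 𝓡 n) p)
  rw [(𝓡 n).range_eq_univ, mfderivWithin_univ] at h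
  exact DFunLike.congr_fun h v

theorem coordinateField_self (p : M) (u : EuclideanSpace ℝ (Fin n)) :
    coordinateField p u p = chartSymmDeriv p u := by
  have h1 := mfderivWithin_extChartAt_symm_comp_mfderiv_extChartAt' (I := 𝓡 n)
    (mem_extChartAt_source (I := 𝓡 n) p)
  have h2 := mfderiv_extChartAt_comp_mfderivWithin_extChartAt_symm' (I := 𝓡 n)
    (mem_extChartAt_source (I := 𝓡 n) p)
  rw [(𝓡 n).range_eq_univ, mfderivWithin_univ] at h1 h2
  rw [coordinateField, VectorField.mpullback_apply]
  exact DFunLike.congr_fun (ContinuousLinearMap.inverse_eq h2 h1) u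

theorem mdifferentiableAt_extChartAt_symm (p : M) :
    MDifferentiableAt 𝓘(ℝ, EuclideanSpace ℝ (Fin n)) (𝓡 n) (extChartAt (𝓡 n) p).symm
      (extChartAt (𝓡 n) p p) := by
  have h := mdifferentiableWithinAt_extChartAt_symm (I := 𝓡 n) (mem_extChartAt_target (I := 𝓡 n) p)
  rwa [(𝓡 n).range_eq_univ, mdifferentiableWithinAt_univ] at h

/-- The derivative of a function on a manifold, read in a chart. -/
theorem hasFDerivAt_comp_extChartAt_symm {g : M → ℝ} {p : M} (hg : MDifferentiableAt (𝓡 n) 𝓘(ℝ, ℝ) g p) :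
    HasFDerivAt (fun y ↦ g ((extChartAt (𝓡 n) p).symm y)) (mvfderiv (𝓡 n) g p ∘L chartSymmDeriv p)
      (extChartAt (𝓡 n) p p) := by
  have hp : (extChartAt (𝓡 n) p).symm (extChartAt (𝓡 n) p p) = p := extChartAt_to_inv p
  have h1 := (mdifferentiableAt_extChartAt_symm (n := n) p).hasMFDerivAt
  have h2 : HasMFDerivAt (𝓡 n) 𝓘(ℝ, ℝ) g ((extChartAt (𝓡 n) p).symm (extChartAt (𝓡 n) p p))
      (mfderiv (𝓡 n) 𝓘(ℝ, ℝ) g p) := by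
    -- The base point of the derivative equals `p` only propositionally, so the rewrite has to act
    -- inside dependent types.
    rw! [hp]
    exact hg.hasMFDerivAt
  exact (h2.comp _ h1).hasFDerivAt

/-- The derivative of a function on a manifold that is differentiable in a chart. -/
theorem mvfderiv_of_hasFDerivAt {f : M → ℝ} {p : M} {D : EuclideanSpace ℝ (Fin n) →L[ℝ] ℝ}
    (hf : HasFDerivAt (fun y ↦ f ((extChartAt (𝓡 n) p).symm y)) D (extChartAt (𝓡 n) p p)) :
    mvfderiv (𝓡 n) f p = D ∘L chartDeriv p := by
  have h1 := (mdifferentiableAt_extChartAt (I := 𝓡 n) (mem_chart_source _ p)).hasMFDerivAt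
  have h2 := (hf.hasMFDerivAt.comp p h1).congr_of_eventuallyEq (f₁ := f) (by
    filter_upwards [extChartAt_source_mem_nhds (I := 𝓡 n) p] with q hq
    exact congrArg f ((extChartAt (𝓡 n) p).left_inv hq).symm)
  exact h2.mfderiv

end Chart

/-! ### Derivatives of a form along an orthonormal frame -/

section Frame

variable {M : Type*} [TopologicalSpace M] [ChartedSpace (EuclideanSpace ℝ (Fin 8)) M]
  [IsManifold (𝓡 8) ∞ M] [RiemannianBundle (TangentSpace (𝓡 8) : M → Type _)]
  [IsContMDiffRiemannianBundle (𝓡 8) ∞ (EuclideanSpace ℝ (Fin 8))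
    (TangentSpace (𝓡 8) : M → Type _)]

/-- The connection form of an orthonormal frame at a point: `(x, u) ↦ (⟪∇_x e_i, u⟫)ᵢ`. -/
def frameConnection (e : Π q : M, OrthonormalBasis (Fin 8) ℝ (TangentSpace (𝓡 8) q)) (p : M) :
    TangentSpace (𝓡 8) p →L[ℝ] TangentSpace (𝓡 8) p →L[ℝ] (Fin 8 → ℝ) :=
  connectionForm fun i ↦ leviCivita (𝓡 8) M (fun q ↦ e q i) p

variable {e : Π q : M, OrthonormalBasis (Fin 8) ℝ (TangentSpace (𝓡 8) q)} {p : M}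
  (he : ∀ i, MDifferentiableAt (𝓡 8) (𝓡 8).tangent
    (fun q ↦ (⟨q, e q i⟩ : TangentBundle (𝓡 8) M)) p)

include he

/-- Metric compatibility applied to the constant functions `⟪e_m, e_b⟫`. -/
theorem frameConnection_skew (x : TangentSpace (𝓡 8) p) (m b : Fin 8) :
    frameConnection e p x (e p b) m = -frameConnection e p x (e p m) b := by
  obtain ⟨X, hX, rfl⟩ := exists_field x
  have h := leviCivita_metric hX (he m) (he b)
  have h0 : (fun q ↦ ⟪e q m, e q b⟫) = fun _ ↦ if m = b then (1 : ℝ) else 0 :=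
    funext fun q ↦ (e q).inner_eq_ite m b
  rw [h0, mvfderiv_const, zero_apply, real_inner_comm _ (e p m)] at h
  exact eq_neg_of_add_eq_zero_left h.symm

/-- The derivative of the components of a vector field in an orthonormal frame. -/
theorem mvfderiv_inner_frame {Y : Π q : M, TangentSpace (𝓡 8) q}
    (hY : MDifferentiableAt (𝓡 8) (𝓡 8).tangent (fun q ↦ (⟨q, Y q⟩ : TangentBundle (𝓡 8) M)) p)
    (x : TangentSpace (𝓡 8) p) (i : Fin 8) :
    mvfderiv (𝓡 8) (fun q ↦ ⟪e q i, Y q⟫) p x =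
      frameConnection e p x (Y p) i + coframe (e p) (leviCivita (𝓡 8) M Y p x) i := by
  obtain ⟨X, hX, rfl⟩ := exists_field x
  exact leviCivita_metric hX (he i) hY

omit he in
theorem hasFDerivAt_continuousStandardForm (v : Fin 4 → Fin 8 → ℝ) :
    HasFDerivAt continuousStandardForm
      (continuousStandardForm.toContinuousMultilinearMap.linearDeriv v) v :=
  continuousStandardForm.toContinuousMultilinearMap.hasFDerivAt v

/-- The covariant derivative of a 4-form that is standard in an orthonormal frame. -/
theorem covDerForm_eq_coframeVariation
    {α : Π q : M, TangentSpace (𝓡 8) q [⋀^Fin 4]→L[ℝ] ℝ}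
    (hα : ∀ᶠ q in nhds p, ∀ v, α q v = standardForm (fun a ↦ coframe (e q) (v a)))
    (X : Π q : M, TangentSpace (𝓡 8) q) (Y : Fin 4 → Π q : M, TangentSpace (𝓡 8) q)
    (hY : ∀ a, MDifferentiableAt (𝓡 8) (𝓡 8).tangent
      (fun q ↦ (⟨q, Y a q⟩ : TangentBundle (𝓡 8) M)) p) :
    covDerForm (leviCivita (𝓡 8) M) α X Y p =
      connectionVariation (e p) (frameConnection e p) (X p) (fun a ↦ Y a p) := by
  -- Near `p` the form depends on the base point only through the frame components of its arguments,
  -- so `α(Y)` is a fixed multilinear function of these scalars and can be differentiated as such.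
  let g : Fin 4 → Fin 8 → M → ℝ := fun a i q ↦ ⟪e q i, Y a q⟫
  have hg : ∀ a i, MDifferentiableAt (𝓡 8) 𝓘(ℝ, ℝ) (g a i) p := fun a i ↦ mdifferentiableAt_inner (he i) (hY a)
  let G : EuclideanSpace ℝ (Fin 8) → Fin 4 → Fin 8 → ℝ :=
    fun y a i ↦ g a i ((extChartAt (𝓡 8) p).symm y)
  have hG : HasFDerivAt G (ContinuousLinearMap.pi fun a ↦ ContinuousLinearMap.pi fun i ↦
      mvfderiv (𝓡 8) (g a i) p ∘L chartSymmDeriv p) (extChartAt (𝓡 8) p p) :=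
    hasFDerivAt_pi.2 fun a ↦ hasFDerivAt_pi.2 fun i ↦ hasFDerivAt_comp_extChartAt_symm (hg a i)
  have hG0 : G (extChartAt (𝓡 8) p p) = fun a ↦ coframe (e p) (Y a p) := by
    funext a i
    exact congrArg (g a i) (extChartAt_to_inv p)
  have hd := ((hasFDerivAt_continuousStandardForm _).comp _ hG).congr_of_eventuallyEq
    (f₁ := fun y ↦ (fun q ↦ α q (fun a ↦ Y a q)) ((extChartAt (𝓡 8) p).symm y)) (by
      have hc := continuousAt_extChartAt_symm (I := 𝓡 8) p
      rw [ContinuousAt, extChartAt_to_inv] at hc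
      filter_upwards [hc.eventually hα] with y hy
      exact hy _)
  have h1 : mvfderiv (𝓡 8) (fun q ↦ α q (fun a ↦ Y a q)) p (X p) =
      ∑ s, standardForm (Function.update (fun a ↦ coframe (e p) (Y a p)) s
        (frameConnection e p (X p) (Y s p) + coframe (e p) (leviCivita (𝓡 8) M (Y s) p (X p)))) := by
    rw [mvfderiv_of_hasFDerivAt hd]
    refine (continuousStandardForm.toContinuousMultilinearMap.linearDeriv_apply _ _).trans
      (Finset.sum_congr rfl fun s _ ↦ ?_)
    refine congrArg standardForm ?_
    rw [hG0]
    refine congrArg _ (funext fun i ↦ ?_)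
    refine Eq.trans ?_ (mvfderiv_inner_frame he (hY s) (X p) i)
    exact congrArg (mvfderiv (𝓡 8) (g s i) p) (chartSymmDeriv_chartDeriv p (X p))
  -- The terms with `∇_X (Y s)` cancel those subtracted in the covariant derivative, which leaves
  -- the connection form alone.
  rw [covDerForm, h1, connectionVariation, coframeVariation_apply, sub_eq_iff_eq_add, ← Finset.sum_add_distrib]
  refine Finset.sum_congr rfl fun s _ ↦ ?_
  rw [AlternatingMap.map_update_add, hα.self_of_nhds]
  refine congrArg _ (congrArg _ (funext fun a ↦ ?_))
  rcases eq_or_ne a s with rfl | h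
  · simp
  · simp [h]

end Frame

/-! ### The exterior derivative along an orthonormal frame -/

section ExteriorDerivative

variable {M : Type*} [TopologicalSpace M] [ChartedSpace (EuclideanSpace ℝ (Fin 8)) M]
  [IsManifold (𝓡 8) ∞ M] [RiemannianBundle (TangentSpace (𝓡 8) : M → Type _)]
  [IsContMDiffRiemannianBundle (𝓡 8) ∞ (EuclideanSpace ℝ (Fin 8))
    (TangentSpace (𝓡 8) : M → Type _)]

/-- The coframe dual to an orthonormal frame, read in the chart at `p`. -/
def chartCoframe (e : Π q : M, OrthonormalBasis (Fin 8) ℝ (TangentSpace (𝓡 8) q)) (p : M)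
    (y : EuclideanSpace ℝ (Fin 8)) : EuclideanSpace ℝ (Fin 8) →L[ℝ] (Fin 8 → ℝ) :=
  coframe (e ((extChartAt (𝓡 8) p).symm y)) ∘L
    mfderiv 𝓘(ℝ, EuclideanSpace ℝ (Fin 8)) (𝓡 8) (extChartAt (𝓡 8) p).symm y

variable {e : Π q : M, OrthonormalBasis (Fin 8) ℝ (TangentSpace (𝓡 8) q)} {p : M}

theorem chartCoframe_self :
    chartCoframe e p (extChartAt (𝓡 8) p p) = coframe (e p) ∘L chartSymmDeriv p := by
  have hp : (extChartAt (𝓡 8) p).symm (extChartAt (𝓡 8) p p) = p := extChartAt_to_inv p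
  -- The frames at `q` and `p` are compared on the common model space, which sidesteps transport
  -- along `q = p`.
  have h : ∀ q, q = p → ∀ u : EuclideanSpace ℝ (Fin 8), coframe (e q) u = coframe (e p) u := by
    rintro q rfl u
    rfl
  ext1 u
  exact h _ hp _

variable (he : ∀ i, MDifferentiableAt (𝓡 8) (𝓡 8).tangent
    (fun q ↦ (⟨q, e q i⟩ : TangentBundle (𝓡 8) M)) p)

include he

theorem hasFDerivAt_chartCoframe_apply (u : EuclideanSpace ℝ (Fin 8)) (i : Fin 8) :
    HasFDerivAt (fun y ↦ chartCoframe e p y u i)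
      (mvfderiv (𝓡 8) (fun q ↦ ⟪e q i, coordinateField p u q⟫) p ∘L chartSymmDeriv p)
      (extChartAt (𝓡 8) p p) := by
  refine (hasFDerivAt_comp_extChartAt_symm
    (mdifferentiableAt_inner (he i) (mdifferentiableAt_coordinateField p u))).congr_of_eventuallyEq ?_
  filter_upwards [extChartAt_target_mem_nhds (I := 𝓡 8) p] with y hy
  rw [coordinateField_extChartAt_symm p u hy]
  rfl

theorem differentiableAt_chartCoframe :
    DifferentiableAt ℝ (chartCoframe e p) (extChartAt (𝓡 8) p p) :=
  differentiableAt_of_clm_apply fun u ↦ differentiableAt_pi.2 fun i ↦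
    (hasFDerivAt_chartCoframe_apply he u i).differentiableAt

/-- Metric compatibility applied to `⟪e_i, ∂_u⟫`. The second term is the Christoffel term, symmetric
in `u` and `v` by `leviCivita_coordinateField_symm`, so `d` does not see it. -/
theorem fderiv_chartCoframe_apply (v u : EuclideanSpace ℝ (Fin 8)) (i : Fin 8) :
    fderiv ℝ (chartCoframe e p) (extChartAt (𝓡 8) p p) v u i =
      frameConnection e p (chartSymmDeriv p v) (chartSymmDeriv p u) i +
        coframe (e p) (leviCivita (𝓡 8) M (coordinateField p u) p (chartSymmDeriv p v)) i := by
  have h1 := (hasFDerivAt_pi'.1 ((differentiableAt_chartCoframe he).hasFDerivAt.clm_apply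
    (hasFDerivAt_const u _)) i).unique (hasFDerivAt_chartCoframe_apply he u i)
  have h2 := mvfderiv_inner_frame he (mdifferentiableAt_coordinateField p u) (chartSymmDeriv p v) i
  rw [coordinateField_self] at h2
  rw [← h2]
  refine Eq.trans ?_ (DFunLike.congr_fun h1 v)
  simp

/-- Vanishing torsion together with commuting coordinate fields. -/
theorem leviCivita_coordinateField_symm (u v : EuclideanSpace ℝ (Fin 8)) :
    leviCivita (𝓡 8) M (coordinateField p u) p (chartSymmDeriv p v) =
      leviCivita (𝓡 8) M (coordinateField p v) p (chartSymmDeriv p u) := by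
  have h := ((leviCivita (𝓡 8) M).torsion_eq_zero_iff).1 leviCivita_torsion
    (mdifferentiableAt_coordinateField p v) (mdifferentiableAt_coordinateField p u)
  rw [mlieBracket_coordinateField, coordinateField_self, coordinateField_self] at h
  exact sub_eq_zero.1 h

/-- The exterior derivative of a 4-form that is standard in an orthonormal frame. -/
theorem extDer_eq_sum_coframeVariation
    {α : Π q : M, TangentSpace (𝓡 8) q [⋀^Fin 4]→L[ℝ] ℝ}
    (hα : ∀ᶠ q in nhds p, ∀ v, α q v = standardForm (fun a ↦ coframe (e q) (v a)))
    (v : Fin 5 → TangentSpace (𝓡 8) p) :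
    extDer α p v = ∑ i : Fin 5, (-1) ^ (i : ℕ) *
      connectionVariation (e p) (frameConnection e p) (v i) (i.removeNth v) := by
  have hc := continuousAt_extChartAt_symm (I := 𝓡 8) p
  rw [ContinuousAt, extChartAt_to_inv] at hc
  have hα' : (fun y : EuclideanSpace ℝ (Fin 8) ↦
      (α ((extChartAt (𝓡 8) p).symm y)).compContinuousLinearMap
        (mfderiv 𝓘(ℝ, EuclideanSpace ℝ (Fin 8)) (𝓡 8) (extChartAt (𝓡 8) p).symm y))
      =ᶠ[nhds (extChartAt (𝓡 8) p p)]
      fun y ↦ continuousStandardForm.compContinuousLinearMap (chartCoframe e p y) := by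
    filter_upwards [hc.eventually hα] with y hy
    ext w
    exact hy _
  have hd := (hasFDerivAt_const continuousStandardForm
    (extChartAt (𝓡 8) p p)).continuousAlternatingMapCompContinuousLinearMap
      (differentiableAt_chartCoframe he).hasFDerivAt
  rw [ContinuousLinearMap.comp_zero, zero_add, chartCoframe_self] at hd
  -- In the chart the form is the pullback of a constant form along the coframe, so its derivative
  -- is the variation along the derivative of the coframe. The inner proof shows that this
  -- derivative and the connection form differ by a symmetric term.
  rw [← alternatizeUncurryFin_fderivComp_coframe (e p) (chartSymmDeriv p) (chartDeriv p)
    (chartSymmDeriv_chartDeriv p) (fderiv ℝ (chartCoframe e p) (extChartAt (𝓡 8) p p))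
    (frameConnection e p) (by
      intro u v
      ext i
      rw [Pi.sub_apply, Pi.sub_apply, fderiv_chartCoframe_apply he, fderiv_chartCoframe_apply he,
        leviCivita_coordinateField_symm he]
      ring), extDer, hα'.extDeriv_eq, extDeriv, hd.fderiv]
  rfl

end ExteriorDerivative

/-! ### The codifferential of the fundamental form -/

section Codifferential

section Algebra

variable {V : Type*} [NormedAddCommGroup V] [InnerProductSpace ℝ V] [FiniteDimensional ℝ V]
  [Fact (finrank ℝ V = 8)]

/-- A 4-form that is standard in an oriented orthonormal basis is self-dual. -/
theorem hodgeStar_standard (o : Orientation ℝ V (Fin 8)) (e : OrthonormalBasis (Fin 8) ℝ V)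
    (he : e.toBasis.orientation = o) (ψ : V [⋀^Fin 4]→L[ℝ] ℝ)
    (hψ : ∀ v, ψ v = standardForm (fun a ↦ coframe e (v a))) :
    hodgeStar o (rfl : 4 + 4 = 8) ψ = ψ := by
  -- The form itself is the part with label `0`; its variations along skew coframe variations carry
  -- the labels `1, …, 7`.
  refine hodgeStar_eq_self o e he ψ (fun r ↦ if r = 0 then 1 else 0) fun w ↦ ?_
  simp only [hψ, coframe_basis, standardForm_single, formCoeff]
  split_ifs <;> simp

/-- The codifferential of a 4-form with exterior derivative given by coframe variations. -/
theorem hodgeStar_sum_coframeVariation (o : Orientation ℝ V (Fin 8))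
    (e : OrthonormalBasis (Fin 8) ℝ V) (he : e.toBasis.orientation = o)
    (N : V →L[ℝ] V →L[ℝ] (Fin 8 → ℝ)) (hN : ∀ x m b, N x (e b) m = -N x (e m) b)
    (α : V [⋀^Fin 5]→L[ℝ] ℝ)
    (hα : ∀ v, α v = ∑ i : Fin 5, (-1) ^ (i : ℕ) * connectionVariation e N (v i) (i.removeNth v))
    (x y z : Fin 8) :
    hodgeStar o (rfl : 5 + 3 = 8) α ![e x, e y, e z] =
      ∑ i, quadSign i x y z * transversePart e (N (e i)) (i ^^^ x ^^^ y ^^^ z) := by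
  rw [hodgeStar_alternatize o e (connectionVariation e N) α hα]
  refine Finset.sum_congr rfl fun i _ ↦ ?_
  have h := coframeVariation_basis e (N (e i)) (hN _)
  rw [connectionVariation, hodgeStar_eq_self o e he _ _ h]
  refine Eq.trans (congrArg _ (funext fun j ↦ ?_)) (h ![i, x, y, z])
  fin_cases j <;> rfl

/-- The covariant derivative of the standard form in terms of its exterior derivative. -/
theorem coframeVariation_eq_hodgeStar (o : Orientation ℝ V (Fin 8))
    (e : OrthonormalBasis (Fin 8) ℝ V) (he : e.toBasis.orientation = o)
    (N : V →L[ℝ] V →L[ℝ] (Fin 8 → ℝ)) (hN : ∀ x m b, N x (e b) m = -N x (e m) b)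
    (Φ : V [⋀^Fin 4]→L[ℝ] ℝ) (hΦ : ∀ v, Φ v = standardForm (fun a ↦ coframe e (v a)))
    (α : V [⋀^Fin 5]→L[ℝ] ℝ)
    (hα : ∀ v, α v = ∑ i : Fin 5, (-1) ^ (i : ℕ) * connectionVariation e N (v i) (i.removeNth v))
    (δ : V [⋀^Fin 3]→L[ℝ] ℝ) (hδ : δ = -hodgeStar o (rfl : 5 + 3 = 8) α)
    (η : V → ℝ) (hη : ∀ v, η v = hodgeStar o (rfl : 3 + 4 + 1 = 8) (wedge δ Φ) ![v])
    (X Y Z T W : V) :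
    connectionVariation e N X ![Y, Z, T, W] =
      (1 / 2) * (δ ![X, Y, crossProduct Φ Z T W] - δ ![X, Z, crossProduct Φ Y T W])
      + (1 / 2) * (δ ![X, T, crossProduct Φ Y Z W] - δ ![X, W, crossProduct Φ Y Z T])
      - (1 / 12) * (η (crossProduct Φ X Y (crossProduct Φ Z T W))
        - η (crossProduct Φ X Z (crossProduct Φ Y T W)))
      - (1 / 12) * (η (crossProduct Φ X T (crossProduct Φ Y Z W))
        - η (crossProduct Φ X W (crossProduct Φ Y Z T))) := by
  rw [connectionVariation]
  refine coframeVariation_eq_codifferential e N hN Φ (ContinuousAlternatingMap.ext hΦ) δ ?_ η ?_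
    X Y Z T W
  · intro x y z
    rw [hδ]
    exact congrArg _ (hodgeStar_sum_coframeVariation o e he N hN α hα x y z)
  · intro v
    rw [hη, hodgeStar_wedge o e δ Φ (hodgeStar_standard o e he Φ hΦ)]

end Algebra

variable {M : Type*} [TopologicalSpace M] [ChartedSpace (EuclideanSpace ℝ (Fin 8)) M]
  [IsManifold (𝓡 8) ∞ M] [RiemannianBundle (TangentSpace (𝓡 8) : M → Type _)]

/-- Self-duality is needed as an identity of fields, not only at one point, because `d` is applied
to it: it turns `δΦ = -⋆d⋆Φ` into `-⋆dΦ`. -/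
theorem star_form (S : Spin7Structure M) : S.star (k := 4) (l := 4) rfl S.form = S.form := by
  funext p
  obtain ⟨U, -, hp, e, -, h⟩ := S.exists_frame p
  exact hodgeStar_standard _ (e p) (h p hp).1 _ (h p hp).2

end Codifferential

end Spin7

end

theorem mainTheorem2 {M : Type*} [TopologicalSpace M] [ChartedSpace (EuclideanSpace ℝ (Fin 8)) M]
    [IsManifold (𝓡 8) ∞ M] [RiemannianBundle (TangentSpace (𝓡 8) : M → Type _)]
    [IsContMDiffRiemannianBundle (𝓡 8) ∞ (EuclideanSpace ℝ (Fin 8))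
      (TangentSpace (𝓡 8) : M → Type _)]
    (S : Spin7.Spin7Structure M) (X Y Z V W : Π p : M, TangentSpace (𝓡 8) p)
    (hX : ContMDiff (𝓡 8) (𝓡 8).tangent ∞ (fun p ↦ (⟨p, X p⟩ : TangentBundle (𝓡 8) M)))
    (hY : ContMDiff (𝓡 8) (𝓡 8).tangent ∞ (fun p ↦ (⟨p, Y p⟩ : TangentBundle (𝓡 8) M)))
    (hZ : ContMDiff (𝓡 8) (𝓡 8).tangent ∞ (fun p ↦ (⟨p, Z p⟩ : TangentBundle (𝓡 8) M)))
    (hV : ContMDiff (𝓡 8) (𝓡 8).tangent ∞ (fun p ↦ (⟨p, V p⟩ : TangentBundle (𝓡 8) M)))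
    (hW : ContMDiff (𝓡 8) (𝓡 8).tangent ∞ (fun p ↦ (⟨p, W p⟩ : TangentBundle (𝓡 8) M)))
    (p : M) :
    Spin7.covDerForm (Spin7.leviCivita (𝓡 8) M) S.form X ![Y, Z, V, W] p =
      (1 / 2) * (S.codiffForm p ![X p, Y p, S.cross (Z p) (V p) (W p)]
        - S.codiffForm p ![X p, Z p, S.cross (Y p) (V p) (W p)])
      + (1 / 2) * (S.codiffForm p ![X p, V p, S.cross (Y p) (Z p) (W p)]
        - S.codiffForm p ![X p, W p, S.cross (Y p) (Z p) (V p)])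
      - (1 / 12) * (S.starCodiffWedge p (S.cross (X p) (Y p) (S.cross (Z p) (V p) (W p)))
        - S.starCodiffWedge p (S.cross (X p) (Z p) (S.cross (Y p) (V p) (W p))))
      - (1 / 12) * (S.starCodiffWedge p (S.cross (X p) (V p) (S.cross (Y p) (Z p) (W p)))
        - S.starCodiffWedge p (S.cross (X p) (W p) (S.cross (Y p) (Z p) (V p)))) := by
  obtain ⟨U, hU, hp, e, hsmooth, hframe⟩ := S.exists_frame p
  have he : ∀ i, MDifferentiableAt (𝓡 8) (𝓡 8).tangent
      (fun q ↦ (⟨q, e q i⟩ : TangentBundle (𝓡 8) M)) p := fun i ↦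
    ((hsmooth i).contMDiffAt (hU.mem_nhds hp)).mdifferentiableAt (by simp)
  have hform : ∀ᶠ q in nhds p, ∀ v,
      S.form q v = Spin7.standardForm (fun a ↦ Spin7.coframe (e q) (v a)) := by
    filter_upwards [hU.mem_nhds hp] with q hq
    exact (hframe q hq).2
  have hfields : ∀ a, MDifferentiableAt (𝓡 8) (𝓡 8).tangent
      (fun q ↦ (⟨q, (![Y, Z, V, W] : Fin 4 → Π q : M, TangentSpace (𝓡 8) q) a q⟩ :
        TangentBundle (𝓡 8) M)) p := by
    intro a
    fin_cases a
    exacts [hY.mdifferentiableAt (by simp), hZ.mdifferentiableAt (by simp),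
      hV.mdifferentiableAt (by simp), hW.mdifferentiableAt (by simp)]
  have hvec : (fun a ↦ (![Y, Z, V, W] : Fin 4 → Π q : M, TangentSpace (𝓡 8) q) a p) =
      ![Y p, Z p, V p, W p] := by
    funext a
    fin_cases a <;> rfl
  rw [Spin7.covDerForm_eq_coframeVariation he hform X _ hfields, hvec]
  have hcodiff : S.codiffForm p = -Spin7.hodgeStar (S.orientation p) (rfl : 5 + 3 = 8)
      (Spin7.extDer S.form p) := by
    rw [Spin7.Spin7Structure.codiffForm, Spin7.star_form]
    rfl
  exact Spin7.coframeVariation_eq_hodgeStar (S.orientation p) (e p) (hframe p hp).1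
    (Spin7.frameConnection e p) (Spin7.frameConnection_skew he) (S.form p) hform.self_of_nhds
    (Spin7.extDer S.form p) (Spin7.extDer_eq_sum_coframeVariation he hform) (S.codiffForm p) hcodiff
    (S.starCodiffWedge p) (fun v ↦ by
      rw [Spin7.Spin7Structure.starCodiffWedge, Spin7.Spin7Structure.star]) (X p) (Y p) (Z p) (V p) (W p)
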